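/- Fix $n\ge 1$ bidders with independent values in $[0,H]$, $H>0$, in a single-item first-price auction: bids are in $[0,H]$, the highest bid wins, ties are broken uniformly at random, and the winner pays her bid. A strategy of bidder $i$ maps her type space $T_i\subseteq[0,H]$ to bids. A (pure or mixed) strategy profile consists, for each bidder $i$, of finitely many strategies $s_{i,l}$ with probabilities $w_{i,l}>0$, $\sum_l w_{i,l}=1$, drawn independently across bidders; it is pure if each bidder has just one strategy, and monotone if all $s_{i,l}$ are weakly increasing on $T_i$. Let $u_i(v,b)$ be the expected utility of bidder $i$ with value $v$ and bid $b$ over the other bidders' values and strategies. The profile is an $\varepsilon$-BNE for $\prod_i F_i$ on the type spaces $T_i$ if $\sum_l w_{i,l}\,u_i(v,s_{i,l}(v))\ge u_i(v,b)-\varepsilon$ for all $i$, all $v\in T_i$ and all $b\in[0,H]$. Algorithms are programs of a real RAM with exact unit-cost arithmetic and comparisons and no real constants except those obtained from natural numbers; a sample-access algorithm may in addition draw independent samples from the $F_i$ in unit time. Let $A$ be an algorithm (without samples) whose input is $n$, $H$, $\varepsilon'$ and a product $\boldsymbol D=\prod_i D_i$ of finitely supported distributions on $[0,H]$ (each given by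 the increasing list of its support points with their positive probabilities), and whose output is a table of the bids of a (pure or mixed) profile at the support points. Then there is a sample-access algorithm $B$ with input $n,H,\varepsilon',\varepsilon,\delta$, whose output is a profile of step functions (lists of breakpoints and bids), such that for all $n\ge1$ and $H>0$: 1. Let $\varepsilon'>0$ and suppose that for every discrete $\boldsymbol D$ as above $A$ outputs a monotone $\varepsilon'$-BNE for $\boldsymbol D$, the type spaces being the supports. Then for all $\varepsilon>0$, $\delta\in(0,1)$, and for arbitrary (possibly continuous) probability distributions $F_i$ concentrated on arbitrary type spaces $T_i\subseteq[0,H]$, with probability at least $1-\delta$ over the samples $B$ outputs a monotone $(\varepsilon'+\varepsilon)$-BNE for $\boldsymbol F=\prod_i F_i$ on the $T_i$. If the equilibria that $A$ outputs are pure, so are those that $B$ outputs. 2. Let $\Gamma\subseteq(0,\infty)$, suppose that $A$ computes monotone $\varepsilon'$-BNE as in 1 for each $\varepsilon'\in\Gamma$, and that for $\varepsilon'\in\Gamma$ its running time is bounded by a polynomial in $1/\varepsilon'$ and the support sizes of the $D_i$ (the polynomial may depend on $n$ and $H$). Then for all $\varepsilon'\in\Gamma$, $\varepsilon>0$, $\delta\in(0,1)$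 and all samples in $[0,H]$, $B$ halts after a number of steps bounded by a polynomial in $1/\varepsilon$, $1/\varepsilon'$ and $\log(1/\delta)$ that depends only on $A$, $n$, $H$ and $\Gamma$, and not on the $F_i$ or their supports. 3. There is a polynomial in $1/\varepsilon$ and $\log(1/\delta)$, depending only on $n$ and $H$, such that for all $\varepsilon>0$, $\delta\in(0,1)$, all $F_i$ and $T_i$ as in 1, and any number $m$ of samples that is at least its value, with probability at least $1-\delta$: for every $\varepsilon'>0$, every monotone $\varepsilon'$-BNE for the empirical product distribution of the $m$ samples on the type spaces $T_i$ is a monotone $(\varepsilon'+\varepsilon)$-BNE for $\boldsymbol F$ on the $T_i$. -/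

import Mathlib

open MeasureTheory

noncomputable section

namespace FPA

/-! ### The first-price auction -/

/-- Probability that bidder `i` wins at bids `b`: the highest bid wins, ties are broken uniformly. -/
def alloc {n : ℕ} (b : Fin n → ℝ) (i : Fin n) : ℝ :=
  open Classical in
  if ∀ j, b j ≤ b i then 1 / ((Finset.univ.filter fun j => ∀ k, b k ≤ b j).card : ℝ) else 0

/-- First-price payment: the winner pays her own bid. -/
def payment {n : ℕ} (b : Fin n → ℝ) (i : Fin n) : ℝ := alloc b i * b i

/-- Ex post utility of bidder `i` with value `v` at bids `b`. -/
def exPostUtility {n : ℕ} (i : Fin n) (v : ℝ) (b : Fin n → ℝ) : ℝ :=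
  v * alloc b i - payment b i

/-- A profile of independently randomized strategies: bidder `i` uses the strategy `strat i l`
(a map from values to bids) with probability `weight i l`, independently of the other bidders. A
profile of pure strategies is the case `count i = 1`. -/
structure Profile (n : ℕ) where
  count : Fin n → ℕ
  weight : (i : Fin n) → Fin (count i) → ℝ
  strat : (i : Fin n) → Fin (count i) → ℝ → ℝ

/-- Whether randomization is allowed. -/
inductive Kind where
  | pure
  | mixed

/-- A profile is of kind `pure` if every bidder has a single strategy. -/
def Profile.HasKind {n : ℕ} (P : Profile n) : Kind → Prop
  | .pure => ∀ i, P.count i = 1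
  | .mixed => True

/-- The weights are probabilities, and all strategies map the type space `T i` to `[0, H]`. -/
def Profile.IsValid {n : ℕ} (P : Profile n) (H : ℝ) (T : Fin n → Set ℝ) : Prop :=
  (∀ i l, 0 < P.weight i l) ∧ (∀ i, ∑ l, P.weight i l = 1) ∧
    ∀ i l, ∀ v ∈ T i, P.strat i l v ∈ Set.Icc 0 H

/-- Every joint strategy that is played with positive probability is weakly increasing. -/
def Profile.IsMonotone {n : ℕ} (P : Profile n) (T : Fin n → Set ℝ) : Prop :=
  ∀ i l, MonotoneOn (P.strat i l) (T i)

/-- Interim utility of bidder `i` with value `v` and bid `b` when the values of the other bidders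
are drawn from the product of the `F j` and their strategies from `P`. The expectation runs over
the values and strategies of all bidders, those of bidder `i` being overwritten by the bid `b`. -/
def interimUtility {n : ℕ} (F : Fin n → Measure ℝ) (P : Profile n) (i : Fin n) (v b : ℝ) : ℝ :=
  ∑ l : (j : Fin n) → Fin (P.count j), (∏ j, P.weight j (l j)) *
    ∫ x, exPostUtility i v (Function.update (fun j => P.strat j (l j) (x j)) i b) ∂(Measure.pi F)

/-- `P` is an `ε`-Bayes Nash equilibrium for the value distribution `∏ F i` on the type spaces
`T i`. -/
def IsBNE {n : ℕ} (H ε : ℝ) (F : Fin n → Measure ℝ) (T : Fin n → Set ℝ) (P : Profile n) : Prop :=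
  ∀ i, ∀ v ∈ T i, ∀ b ∈ Set.Icc 0 H,
    interimUtility F P i v b - ε ≤
      ∑ l, P.weight i l * interimUtility F P i v (P.strat i l v)

/-- `P` is a monotone `ε`-BNE of the given kind, with bids in `[0, H]`. -/
def IsMonotoneBNE {n : ℕ} (κ : Kind) (H ε : ℝ) (F : Fin n → Measure ℝ) (T : Fin n → Set ℝ)
    (P : Profile n) : Prop :=
  P.HasKind κ ∧ P.IsValid H T ∧ P.IsMonotone T ∧ IsBNE H ε F T P

/-! ### Discrete and empirical product distributions -/

/-- A product of finitely supported distributions on `[0, H]`: the support of the `i`-th one has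
`size i` points `val i 0 < val i 1 < ⋯`, with positive probabilities `prob i k`. Entries with
`k ≥ size i` are irrelevant. -/
structure DiscreteProduct (n : ℕ) (H : ℝ) where
  size : Fin n → ℕ
  val : Fin n → ℕ → ℝ
  prob : Fin n → ℕ → ℝ
  val_mem : ∀ i, ∀ k < size i, val i k ∈ Set.Icc 0 H
  val_lt : ∀ i, ∀ k l, k < l → l < size i → val i k < val i l
  prob_pos : ∀ i, ∀ k < size i, 0 < prob i k
  prob_sum : ∀ i, ∑ k ∈ Finset.range (size i), prob i k = 1

/-- The `i`-th marginal. -/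
def DiscreteProduct.marginal {n : ℕ} {H : ℝ} (D : DiscreteProduct n H) (i : Fin n) : Measure ℝ :=
  ∑ k ∈ Finset.range (D.size i), ENNReal.ofReal (D.prob i k) • Measure.dirac (D.val i k)

/-- The support of the `i`-th marginal. -/
def DiscreteProduct.support {n : ℕ} {H : ℝ} (D : DiscreteProduct n H) (i : Fin n) : Set ℝ :=
  {v | ∃ k < D.size i, v = D.val i k}

/-- The `i`-th marginal of the empirical product distribution of the samples `ω 0, …, ω (m - 1)`:
the uniform distribution over the `i`-th coordinates of the samples. -/
def empirical {n : ℕ} (m : ℕ) (ω : ℕ → Fin n → ℝ) (i : Fin n) : Measure ℝ :=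
  ((m : ENNReal)⁻¹) • ∑ j ∈ Finset.range m, Measure.dirac (ω j i)

/-- The law of an infinite sequence of independent samples from the product of the `F i`. -/
def sampleLaw {n : ℕ} (F : Fin n → Measure ℝ) [∀ i, IsProbabilityMeasure (F i)] :
    Measure (ℕ → Fin n → ℝ) :=
  Measure.infinitePi fun _ : ℕ => Measure.pi F

/-! ### A real random access machine

Programs of a real RAM in structured form. The memory consists of arrays of natural numbers and
arrays of real numbers (a scalar variable is a cell of an array). Exact arithmetic operations and
comparisons take unit time; there are no real constants other than those obtained from natural
numbers, and there is no rounding. Every command and every evaluation of a test costs one step; as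
the expressions are part of the program, charging for their size would change the running time
only by a constant factor that depends on the program. -/

/-- A memory state. `nat a i` is cell `i` of the array `a` of natural numbers, `real a i j k` is
cell `(i, j, k)` of the array `a` of reals, and `drawn i` is the number of values that have been
sampled for bidder `i`. -/
structure State where
  nat : ℕ → ℕ → ℕ
  real : ℕ → ℕ → ℕ → ℕ → ℝ
  drawn : ℕ → ℕ

/-- Expressions with values in the natural numbers (`sub` is truncated). -/
inductive NatExp where
  | const (k : ℕ)
  | cell (a : ℕ) (i : NatExp)
  | add (e f : NatExp)
  | sub (e f : NatExp)

def NatExp.eval (σ : State) : NatExp → ℕ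
  | const k => k
  | cell a i => σ.nat a (i.eval σ)
  | add e f => e.eval σ + f.eval σ
  | sub e f => e.eval σ - f.eval σ

/-- Expressions with values in the reals (a division by zero gives zero). -/
inductive RealExp where
  | ofNat (e : NatExp)
  | cell (a : ℕ) (i j k : NatExp)
  | add (e f : RealExp)
  | sub (e f : RealExp)
  | mul (e f : RealExp)
  | div (e f : RealExp)

def RealExp.eval (σ : State) : RealExp → ℝ
  | ofNat e => (e.eval σ : ℝ)
  | cell a i j k => σ.real a (i.eval σ) (j.eval σ) (k.eval σ)
  | add e f => e.eval σ + f.eval σ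
  | sub e f => e.eval σ - f.eval σ
  | mul e f => e.eval σ * f.eval σ
  | div e f => e.eval σ / f.eval σ

/-- Tests. -/
inductive Test where
  | natLt (e f : NatExp)
  | realLt (e f : RealExp)
  | not (p : Test)
  | and (p q : Test)

def Test.Holds (σ : State) : Test → Prop
  | natLt e f => e.eval σ < f.eval σ
  | realLt e f => e.eval σ < f.eval σ
  | not p => ¬ p.Holds σ
  | and p q => p.Holds σ ∧ q.Holds σ

/-- Programs. `draw a i j k e` stores a fresh sample of the value of bidder `e` in the cell
`(i, j, k)` of the real array `a`. -/
inductive Cmd where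
  | skip
  | setNat (a : ℕ) (i : NatExp) (e : NatExp)
  | setReal (a : ℕ) (i j k : NatExp) (e : RealExp)
  | draw (a : ℕ) (i j k : NatExp) (e : NatExp)
  | seq (c d : Cmd)
  | ite (p : Test) (c d : Cmd)
  | loop (p : Test) (c : Cmd)

/-- The program does not use samples. -/
def Cmd.DrawFree : Cmd → Prop
  | skip => True
  | setNat _ _ _ => True
  | setReal _ _ _ _ _ => True
  | draw _ _ _ _ _ => False
  | seq c d => c.DrawFree ∧ d.DrawFree
  | ite _ c d => c.DrawFree ∧ d.DrawFree
  | loop _ c => c.DrawFree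

def State.setNat (σ : State) (a i x : ℕ) : State :=
  { σ with nat := fun a' i' => if a' = a ∧ i' = i then x else σ.nat a' i' }

def State.setReal (σ : State) (a i j k : ℕ) (x : ℝ) : State :=
  { σ with real := fun a' i' j' k' =>
      if a' = a ∧ i' = i ∧ j' = j ∧ k' = k then x else σ.real a' i' j' k' }

def State.countDraw (σ : State) (e : ℕ) : State :=
  { σ with drawn := fun e' => if e' = e then σ.drawn e + 1 else σ.drawn e' }

/-- `Exec S c σ σ' t`: started in the state `σ`, the program `c` halts in the state `σ'` after
exactly `t` steps, where `S j i` is the `j`-th sample of the value of bidder `i`. -/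
inductive Exec (S : ℕ → ℕ → ℝ) : Cmd → State → State → ℕ → Prop where
  | skip (σ) : Exec S .skip σ σ 1
  | setNat (σ a i e) : Exec S (.setNat a i e) σ (σ.setNat a (i.eval σ) (e.eval σ)) 1
  | setReal (σ a i j k e) :
      Exec S (.setReal a i j k e) σ
        (σ.setReal a (i.eval σ) (j.eval σ) (k.eval σ) (e.eval σ)) 1
  | draw (σ a i j k e) :
      Exec S (.draw a i j k e) σ
        ((σ.setReal a (i.eval σ) (j.eval σ) (k.eval σ)
          (S (σ.drawn (e.eval σ)) (e.eval σ))).countDraw (e.eval σ)) 1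
  | seq {c d σ₁ σ₂ σ₃ t u} (hc : Exec S c σ₁ σ₂ t) (hd : Exec S d σ₂ σ₃ u) :
      Exec S (.seq c d) σ₁ σ₃ (t + u)
  | ite_true {p c d σ σ' t} (hp : p.Holds σ) (hc : Exec S c σ σ' t) :
      Exec S (.ite p c d) σ σ' (t + 1)
  | ite_false {p c d σ σ' t} (hp : ¬ p.Holds σ) (hd : Exec S d σ σ' t) :
      Exec S (.ite p c d) σ σ' (t + 1)
  | loop_stop {p c σ} (hp : ¬ p.Holds σ) : Exec S (.loop p c) σ σ 1
  | loop_step {p c σ₁ σ₂ σ₃ t u} (hp : p.Holds σ₁) (hc : Exec S c σ₁ σ₂ t)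
      (hl : Exec S (.loop p c) σ₂ σ₃ u) : Exec S (.loop p c) σ₁ σ₃ (t + u + 1)

/-! ### Input and output formats -/

/-- Extension by zero of data indexed by bidders. -/
def extend {n : ℕ} {α : Type} [Zero α] (f : Fin n → α) (i : ℕ) : α :=
  if h : i < n then f ⟨i, h⟩ else 0

/-- The input of an algorithm for discrete distributions. Natural numbers: the number `n` of bidders
in array `0`, the sizes of the supports in array `1`. Reals: `H` in array `0`, the accuracy `ε'` in
array `1`, the support points in array `2`, their probabilities in array `3`. All other cells are
zero. -/
def discreteInput {n : ℕ} {H : ℝ} (ε' : ℝ) (D : DiscreteProduct n H) : State where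
  nat a i :=
    if a = 0 ∧ i = 0 then n
    else if a = 1 then extend D.size i
    else 0
  real a i j k :=
    if a = 0 ∧ i = 0 ∧ j = 0 ∧ k = 0 then H
    else if a = 1 ∧ i = 0 ∧ j = 0 ∧ k = 0 then ε'
    else if a = 2 ∧ j < extend D.size i ∧ k = 0 then extend (fun i' => D.val i' j) i
    else if a = 3 ∧ j < extend D.size i ∧ k = 0 then extend (fun i' => D.prob i' j) i
    else 0
  drawn _ := 0

/-- The input of a sampling algorithm: the number `n` of bidders in array `0` of natural numbers,
`H`, `ε'`, `ε`, `δ` in the real arrays `0`, `1`, `6`, `7`. All other cells are zero. -/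
def samplingInput (n : ℕ) (H ε' ε δ : ℝ) : State where
  nat a i := if a = 0 ∧ i = 0 then n else 0
  real a i j k :=
    if i = 0 ∧ j = 0 ∧ k = 0 then
      (if a = 0 then H else if a = 1 then ε' else if a = 6 then ε else if a = 7 then δ else 0)
    else 0
  drawn _ := 0

/-- The step function with the `K` breakpoints `t 0 < t 1 < ⋯` that has the value `b k` from
`t k` on (up to the next breakpoint), and `0` before the first breakpoint. -/
def stepFun (K : ℕ) (t b : ℕ → ℝ) (v : ℝ) : ℝ :=
  open Classical in
  let c := ((Finset.range K).filter fun k => t k ≤ v).card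
  if c = 0 then 0 else b (c - 1)

/-- The profile in the state `σ`: the number of strategies of bidder `i` is in array `2` of natural
numbers, the weights are in the real array `4`, and cell `(i, l, k)` of the real array `5` holds the
bid of the `l`-th strategy of bidder `i` from the `k`-th breakpoint on. -/
def State.profile {n : ℕ} (σ : State) (K : Fin n → ℕ) (t : Fin n → ℕ → ℝ) : Profile n where
  count i := σ.nat 2 i
  weight i l := σ.real 4 i l 0
  strat i l := stepFun (K i) (t i) fun k => σ.real 5 i l k

/-- The output of an algorithm for discrete distributions: one bid for each strategy and each point
of the support (only the bids at the points of the support matter). -/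
def discreteOutput {n : ℕ} {H : ℝ} (D : DiscreteProduct n H) (σ : State) : Profile n :=
  σ.profile D.size D.val

/-- The output of a sampling algorithm: step functions, the numbers of breakpoints being in array
`1` of natural numbers, the breakpoints in the real array `2`. -/
def samplingOutput (n : ℕ) (σ : State) : Profile n :=
  σ.profile (fun i => σ.nat 1 i) fun i k => σ.real 2 i k 0

/-! ### Algorithms for equilibria -/

/-- `A` computes a monotone `ε'`-BNE of the first-price auction for every discrete product
distribution on `[0, H]`, the type spaces being the supports. -/
def ComputesDiscreteBNE (A : Cmd) (n : ℕ) (H : ℝ) (κ : Kind) (ε' : ℝ) : Prop :=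
  ∀ D : DiscreteProduct n H, ∃ σ t, Exec 0 A (discreteInput ε' D) σ t ∧
    IsMonotoneBNE κ H ε' D.marginal D.support (discreteOutput D σ)

/-- On every product distribution on type spaces `T i ⊆ [0, H]`, the sampling algorithm `B` halts
with a monotone `(ε' + ε)`-BNE, except with probability at most `δ` over the samples. -/
def ComputesBNEFromSamples (B : Cmd) (n : ℕ) (H : ℝ) (κ : Kind) (ε' ε δ : ℝ) : Prop :=
  ∀ (T : Fin n → Set ℝ) (F : Fin n → Measure ℝ) [∀ i, IsProbabilityMeasure (F i)],
    (∀ i, T i ⊆ Set.Icc 0 H) → (∀ i, ∀ᵐ v ∂(F i), v ∈ T i) →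
    sampleLaw F {ω | ¬ ∃ σ t,
      Exec (fun j => extend (ω j)) B (samplingInput n H ε' ε δ) σ t ∧
      IsMonotoneBNE κ H (ε' + ε) F T (samplingOutput n σ)} ≤ ENNReal.ofReal δ

/-- The running time of `A` on discrete distributions is polynomial in `1 / ε'` and the sizes of the
supports, for the accuracies `ε' ∈ Γ`. -/
def PolyTimeDiscrete (A : Cmd) (n : ℕ) (H : ℝ) (Γ : Set ℝ) : Prop :=
  ∃ C d : ℕ, ∀ ε' ∈ Γ, ∀ D : DiscreteProduct n H, ∃ σ t,
    Exec 0 A (discreteInput ε' D) σ t ∧ (t : ℝ) ≤ C * (1 + 1 / ε' + ∑ i, (D.size i : ℝ)) ^ d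

/-- The running time of the sampling algorithm `B` is polynomial in `1 / ε`, `1 / ε'` and
`log (1 / δ)`, for the accuracies `ε' ∈ Γ`, whatever the samples in `[0, H]`. -/
def PolyTimeSampling (B : Cmd) (n : ℕ) (H : ℝ) (Γ : Set ℝ) : Prop :=
  ∃ C d : ℕ, ∀ ε' ∈ Γ, ∀ ε δ : ℝ, 0 < ε → 0 < δ → δ < 1 →
    ∀ ω : ℕ → Fin n → ℝ, (∀ j i, ω j i ∈ Set.Icc 0 H) → ∃ σ t,
      Exec (fun j => extend (ω j)) B (samplingInput n H ε' ε δ) σ t ∧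
      (t : ℝ) ≤ C * (1 + 1 / ε + 1 / ε' + Real.log (1 / δ)) ^ d

/-- With polynomially many samples, except with probability at most `δ`, every monotone `ε'`-BNE of
the auction with the empirical product distribution (for any `ε'`) is an `(ε' + ε)`-BNE of the
auction with the true distribution on the same type spaces. -/
def EmpiricalEquilibriaTransfer (n : ℕ) (H : ℝ) : Prop :=
  ∃ C d : ℕ, ∀ ε δ : ℝ, 0 < ε → 0 < δ → δ < 1 →
    ∀ m : ℕ, C * (1 + 1 / ε + Real.log (1 / δ)) ^ d ≤ (m : ℝ) →
    ∀ (T : Fin n → Set ℝ) (F : Fin n → Measure ℝ) [∀ i, IsProbabilityMeasure (F i)],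
      (∀ i, T i ⊆ Set.Icc 0 H) → (∀ i, ∀ᵐ v ∂(F i), v ∈ T i) →
      sampleLaw F {ω | ∃ (P : Profile n) (ε' : ℝ), 0 < ε' ∧
        IsMonotoneBNE .mixed H ε' (empirical m ω) T P ∧
        ¬ IsMonotoneBNE .mixed H (ε' + ε) F T P} ≤ ENNReal.ofReal δ

end FPA

end

/-! A bidder's own value and strategy do not affect her chance of winning with a given bid `b`, so
her interim utility is `(v - b)` times a winning probability (`interimUtility_eq`). Expanding over
the set of opponents tied at `b` and using independence, this probability is a polynomial in the
numbers `P(bid j < b)` and `P(bid j = b)` (`alloc_eq_sum_prod`, `integral_alloc_update`). If the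
distribution functions of all bids move by at most `η`, a hybrid argument bounds the change of the
winning probability by `3nη`, hence that of the utility by `3nHη` (`abs_winProb_sub_le`,
`abs_interimUtility_sub_le`). Both sides of the equilibrium inequality move, so an equilibrium loses
at most twice this amount.

Monotonicity makes the bound uniform over all profiles: a monotone strategy pulls back a lower set
of bids to the trace on `T i` of a lower set of values. Uniform closeness of the empirical marginals
on lower sets of the line therefore controls all monotone profiles and all bids at once
(`bidsClose_of_uniformlyClose`). This closeness follows from Hoeffding's inequality and a union
bound over finitely many bracketing sets (`sampleLaw_not_uniformlyClose_le`). These facts give the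
transfer of empirical equilibria.

The sampling algorithm rounds the samples down to a grid of `K` points in `[0, H)`, adds one to
every cell count, and runs `A` on the resulting distribution. The added counts give all grid points
positive probability, so the support is the whole grid and its size does not depend on the samples.
The table returned by `A` is extended by step functions constant on the cells. Such strategies do
not notice the rounding of the opponents' values; the smoothing costs `1 / K` in the bid
distributions, and rounding the bidder's own value costs `H / K` in utility
(`isMonotoneBNE_of_smoothed`). The weights and bids are kept, so purity is preserved.

On the machine side, the program keeps its own data in arrays beyond those used by `A`. By
`Exec.simulate`, `A` then behaves as on its prescribed input and leaves these registers intact.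
`exec_samplingAlgorithm` combines this with loop invariants for the remaining programs and a step
count. -/

noncomputable section

namespace FPA

/-! ### Winning probabilities -/

/-- The factor of bidder `j` in the expansion of `alloc` over the sets `S` of tied opponents. -/
def tieFactor {ι : Type*} [DecidableEq ι] (p q : ι → ℝ) (S : Finset ι) (j : ι) : ℝ :=
  if j ∈ S then q j else p j

theorem prod_tieFactor_insert {ι : Type*} [DecidableEq ι] (p q : ι → ℝ) {a : ι} {s S : Finset ι}
    (ha : a ∉ s) (hS : S ⊆ s) :
    ∏ j ∈ insert a s, tieFactor p q S j = p a * ∏ j ∈ s, tieFactor p q S j ∧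
    ∏ j ∈ insert a s, tieFactor p q (insert a S) j = q a * ∏ j ∈ s, tieFactor p q S j := by
  have haS : a ∉ S := fun h => ha (hS h)
  rw [Finset.prod_insert ha, Finset.prod_insert ha]
  refine ⟨by simp [tieFactor, haS], ?_⟩
  congr 1
  · simp [tieFactor]
  · refine Finset.prod_congr rfl fun j hj => ?_
    have : j ≠ a := fun h => ha (h ▸ hj)
    simp [tieFactor, this]

theorem tieFactor_nonneg {ι : Type*} [DecidableEq ι] {p q : ι → ℝ} (hp : ∀ j, 0 ≤ p j)
    (hq : ∀ j, 0 ≤ q j) (S : Finset ι) (j : ι) : 0 ≤ tieFactor p q S j := by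
  unfold tieFactor; split_ifs
  · exact hq j
  · exact hp j

/-- The sum is the expansion of `∏ j ∈ s, (p j + q j)`, a product of factors in `[0, 1]`. -/
theorem sum_prod_tieFactor_le_one {ι : Type*} [DecidableEq ι] {p q : ι → ℝ} (hp : ∀ j, 0 ≤ p j)
    (hq : ∀ j, 0 ≤ q j) (hpq : ∀ j, p j + q j ≤ 1) (s : Finset ι) :
    ∑ S ∈ s.powerset, ∏ j ∈ s, tieFactor p q S j ≤ 1 := by
  induction s using Finset.induction_on with
  | empty => simp
  | insert a s ha ih =>
    rw [Finset.sum_powerset_insert ha, ← Finset.sum_add_distrib]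
    calc _ = ∑ S ∈ s.powerset, (p a + q a) * ∏ j ∈ s, tieFactor p q S j := by
          refine Finset.sum_congr rfl fun S hS => ?_
          obtain ⟨h1, h2⟩ := prod_tieFactor_insert p q ha (Finset.mem_powerset.1 hS)
          rw [h1, h2]; ring
      _ = (p a + q a) * ∑ S ∈ s.powerset, ∏ j ∈ s, tieFactor p q S j := by
          rw [Finset.mul_sum]
      _ ≤ 1 := by
          refine mul_le_one₀ (hpq a) ?_ ih
          exact Finset.sum_nonneg fun S _ => Finset.prod_nonneg fun j _ =>
            tieFactor_nonneg hp hq S j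

/-- Hybrid argument: the factors are exchanged one bidder at a time. An unchanged factor contributes
`p + q ≤ 1` and the remaining product has total mass at most one, so the number of subsets does not
enter the bound. -/
theorem sum_abs_prod_tieFactor_sub_le {ι : Type*} [DecidableEq ι] {p q p' q' : ι → ℝ}
    (hp : ∀ j, 0 ≤ p j) (hq : ∀ j, 0 ≤ q j) (hpq : ∀ j, p j + q j ≤ 1)
    (hp' : ∀ j, 0 ≤ p' j) (hq' : ∀ j, 0 ≤ q' j) (hpq' : ∀ j, p' j + q' j ≤ 1) (s : Finset ι) :
    ∑ S ∈ s.powerset, |∏ j ∈ s, tieFactor p q S j - ∏ j ∈ s, tieFactor p' q' S j| ≤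
      ∑ j ∈ s, (|p j - p' j| + |q j - q' j|) := by
  induction s using Finset.induction_on with
  | empty => simp
  | insert a s ha ih =>
    rw [Finset.sum_powerset_insert ha, ← Finset.sum_add_distrib, Finset.sum_insert ha]
    set X : Finset ι → ℝ := fun S => ∏ j ∈ s, tieFactor p q S j
    set X' : Finset ι → ℝ := fun S => ∏ j ∈ s, tieFactor p' q' S j
    have hX' : ∀ S, 0 ≤ X' S := fun S => Finset.prod_nonneg fun j _ => tieFactor_nonneg hp' hq' S j
    have key : ∀ u u' x x' : ℝ, 0 ≤ u → 0 ≤ x' →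
        |u * x - u' * x'| ≤ u * |x - x'| + |u - u'| * x' := by
      intro u u' x x' hu hx
      calc |u * x - u' * x'| = |u * (x - x') + (u - u') * x'| := by ring_nf
        _ ≤ |u * (x - x')| + |(u - u') * x'| := abs_add_le _ _
        _ = _ := by rw [abs_mul, abs_mul, abs_of_nonneg hu, abs_of_nonneg hx]
    calc _ ≤ ∑ S ∈ s.powerset, ((p a + q a) * |X S - X' S| +
            (|p a - p' a| + |q a - q' a|) * X' S) := by
          refine Finset.sum_le_sum fun S hS => ?_
          obtain ⟨h1, h2⟩ := prod_tieFactor_insert p q ha (Finset.mem_powerset.1 hS)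
          obtain ⟨h3, h4⟩ := prod_tieFactor_insert p' q' ha (Finset.mem_powerset.1 hS)
          rw [h1, h2, h3, h4]
          have := key (p a) (p' a) (X S) (X' S) (hp a) (hX' S)
          have := key (q a) (q' a) (X S) (X' S) (hq a) (hX' S)
          simp only [X, X'] at *
          linarith
      _ = (p a + q a) * ∑ S ∈ s.powerset, |X S - X' S| +
            (|p a - p' a| + |q a - q' a|) * ∑ S ∈ s.powerset, X' S := by
          rw [Finset.sum_add_distrib, Finset.mul_sum, Finset.mul_sum]
      _ ≤ 1 * (∑ S ∈ s.powerset, |X S - X' S|) + (|p a - p' a| + |q a - q' a|) * 1 := by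
          refine add_le_add (mul_le_mul_of_nonneg_right (hpq a) ?_)
            (mul_le_mul_of_nonneg_left ?_ (by positivity))
          · exact Finset.sum_nonneg fun _ _ => abs_nonneg _
          · exact sum_prod_tieFactor_le_one hp' hq' hpq' s
      _ ≤ _ := by linarith

/-- Only the actual set of opponents tied with `i` can give a nonzero product, and its product
vanishes if somebody bids more than `i`. The coefficient is the uniform tie-breaking probability,
with `i` counted among the tied. -/
theorem alloc_eq_sum_prod {n : ℕ} (b : Fin n → ℝ) (i : Fin n) :
    alloc b i = ∑ S ∈ (Finset.univ.erase i).powerset, ((S.card : ℝ) + 1)⁻¹ *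
      ∏ j ∈ Finset.univ.erase i, tieFactor (fun j => if b j < b i then 1 else 0)
        (fun j => if b j = b i then 1 else 0) S j := by
  classical
  set E := (Finset.univ.erase i).filter fun j => b j = b i with hE
  rw [Finset.sum_eq_single E]
  · unfold alloc
    split_ifs with h
    · have h1 : ∀ j ∈ Finset.univ.erase i, tieFactor (fun j => if b j < b i then (1 : ℝ) else 0)
        (fun j => if b j = b i then 1 else 0) E j = 1 := by
        intro j hj
        by_cases hb : b j = b i
        · simp [tieFactor, hE, hb, Finset.ne_of_mem_erase hj]
        · simp [tieFactor, hE, hb, lt_of_le_of_ne (h j) hb]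
      rw [Finset.prod_congr rfl h1]
      have h2 : (Finset.univ.filter fun j => ∀ k, b k ≤ b j) = insert i E := by
        ext j
        simp only [Finset.mem_filter, Finset.mem_univ, true_and, Finset.mem_insert, hE,
          Finset.mem_erase, and_true]
        constructor
        · intro hj
          by_cases hji : j = i
          · exact Or.inl hji
          · exact Or.inr ⟨hji, le_antisymm (h j) (hj i)⟩
        · rintro (rfl | ⟨-, hj⟩) k
          · exact h k
          · rw [hj]; exact h k
      have h3 : i ∉ E := by simp [hE]
      rw [show (Finset.univ.filter fun j => ∀ k, b k ≤ b j).card = E.card + 1 by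
        rw [h2, Finset.card_insert_of_notMem h3]]
      simp
    · push Not at h
      obtain ⟨j, hj⟩ := h
      rw [Finset.prod_eq_zero (i := j), mul_zero]
      · exact Finset.mem_erase.2 ⟨fun h => by simp [h] at hj, Finset.mem_univ _⟩
      · simp [tieFactor, hE, hj.ne', hj.not_gt]
  · intro S hS hSE
    have : ∃ j ∈ Finset.univ.erase i, ¬ (j ∈ S ↔ b j = b i) := by
      by_contra! hcon
      refine hSE (Finset.ext fun j => ?_)
      rw [hE, Finset.mem_filter]
      constructor
      · intro hj
        exact ⟨Finset.mem_powerset.1 hS hj, (hcon j (Finset.mem_powerset.1 hS hj)).1 hj⟩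
      · rintro ⟨h1, h2⟩; exact (hcon j h1).2 h2
    obtain ⟨j, hj, hjS⟩ := this
    rw [Finset.prod_eq_zero hj, mul_zero]
    by_cases hb : b j = b i
    · have : j ∉ S := fun h => hjS (by simp [h, hb])
      simp [tieFactor, this, hb]
    · have : j ∈ S := by_contra fun h => hjS (by simp [h, hb])
      simp [tieFactor, this, hb]
  · intro h
    exact absurd (Finset.mem_powerset.2 (Finset.filter_subset _ _)) h

theorem alloc_mem_Icc {n : ℕ} (b : Fin n → ℝ) (i : Fin n) : alloc b i ∈ Set.Icc 0 1 := by
  unfold alloc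
  split_ifs with h
  · refine ⟨by positivity, ?_⟩
    have : 0 < (Finset.univ.filter fun j => ∀ k, b k ≤ b j).card :=
      Finset.card_pos.2 ⟨i, by simpa using h⟩
    rw [div_le_one (by exact_mod_cast this)]
    exact_mod_cast this
  · simp

/-- Probability that bidder `i` wins with the bid `b`. -/
def winProb {n : ℕ} (F : Fin n → Measure ℝ) (P : Profile n) (i : Fin n) (b : ℝ) : ℝ :=
  ∑ l : (j : Fin n) → Fin (P.count j), (∏ j, P.weight j (l j)) *
    ∫ x, alloc (Function.update (fun j => P.strat j (l j) (x j)) i b) i ∂(Measure.pi F)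

/-- The payment on winning is the fixed number `b`, so distributions and strategies enter only
through the winning probability. -/
theorem interimUtility_eq {n : ℕ} (F : Fin n → Measure ℝ) (P : Profile n) (i : Fin n) (v b : ℝ) :
    interimUtility F P i v b = (v - b) * winProb F P i b := by
  unfold interimUtility winProb
  rw [Finset.mul_sum]
  refine Finset.sum_congr rfl fun l _ => ?_
  rw [mul_left_comm, ← integral_const_mul (v - b)]
  congr 1
  refine integral_congr_ae (Filter.Eventually.of_forall fun x => ?_)
  simp only [exPostUtility, payment, Function.update_self]
  ring

theorem Profile.IsValid.sum_prod_weight {n : ℕ} {P : Profile n} {H : ℝ} {T : Fin n → Set ℝ}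
    (hP : P.IsValid H T) : ∑ l : (j : Fin n) → Fin (P.count j), ∏ j, P.weight j (l j) = 1 := by
  have := (Finset.prod_univ_sum (fun j => (Finset.univ : Finset (Fin (P.count j))))
    (fun j l => P.weight j l)).symm
  rw [Fintype.piFinset_univ] at this
  rw [this]
  exact Finset.prod_eq_one fun j _ => hP.2.1 j

theorem winProb_mem_Icc {n : ℕ} (F : Fin n → Measure ℝ) [∀ i, IsProbabilityMeasure (F i)]
    {P : Profile n} {H : ℝ} {T : Fin n → Set ℝ} (hP : P.IsValid H T) (i : Fin n) (b : ℝ) :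
    winProb F P i b ∈ Set.Icc 0 1 := by
  have hw : ∀ l : (j : Fin n) → Fin (P.count j), 0 ≤ ∏ j, P.weight j (l j) := fun l =>
    Finset.prod_nonneg fun j _ => (hP.1 j (l j)).le
  have h0 : ∀ l : (j : Fin n) → Fin (P.count j), 0 ≤ ∫ x, alloc (Function.update
      (fun j => P.strat j (l j) (x j)) i b) i ∂(Measure.pi F) := fun l =>
    integral_nonneg fun x => (alloc_mem_Icc _ _).1
  refine ⟨Finset.sum_nonneg fun l _ => mul_nonneg (hw l) (h0 l), ?_⟩
  rw [← hP.sum_prod_weight]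
  refine Finset.sum_le_sum fun l _ => mul_le_of_le_one_right (hw l) ?_
  have := norm_integral_le_of_norm_le_const (μ := Measure.pi F) (C := 1)
    (f := fun x => alloc (Function.update (fun j => P.strat j (l j) (x j)) i b) i)
    (Filter.Eventually.of_forall fun x => by
      rw [Real.norm_of_nonneg (alloc_mem_Icc _ _).1]; exact (alloc_mem_Icc _ _).2)
  simpa using (le_abs_self _).trans this

/-! ### Measurability and integration for monotone strategies. -/

/-- The lower set of the line generated by a part of `T`. -/
theorem exists_isLowerSet_inter {T : Set ℝ} {s : ℝ → ℝ} (hs : MonotoneOn s T) {B : Set ℝ}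
    (hB : IsLowerSet B) : ∃ A, IsLowerSet A ∧ ∀ x ∈ T, (x ∈ A ↔ s x ∈ B) := by
  refine ⟨lowerClosure {x ∈ T | s x ∈ B}, (lowerClosure _).lower, fun x hx => ⟨?_, fun h => ?_⟩⟩
  · rintro ⟨y, ⟨hy, hyb⟩, hxy⟩
    exact hB (hs hx hy hxy) hyb
  · exact subset_lowerClosure ⟨hx, h⟩

theorem isLowerSet_measurableSet {A : Set ℝ} (hA : IsLowerSet A) : MeasurableSet A :=
  hA.ordConnected.measurableSet

theorem ae_eq_of_forall_mem {μ : Measure ℝ} {T A B : Set ℝ} (hT : ∀ᵐ x ∂μ, x ∈ T)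
    (h : ∀ x ∈ T, (x ∈ A ↔ x ∈ B)) : A =ᵐ[μ] B := by
  filter_upwards [hT] with x hx
  exact propext (h x hx)

/-- Off `T` the strategy is arbitrary, and `T` itself need not be measurable. Up to a null set the
preimage is still a lower set of the line, which is Borel. -/
theorem nullMeasurableSet_preimage {μ : Measure ℝ} {T : Set ℝ} (hT : ∀ᵐ x ∂μ, x ∈ T) {s : ℝ → ℝ}
    (hs : MonotoneOn s T) {B : Set ℝ} (hB : IsLowerSet B) : NullMeasurableSet {x | s x ∈ B} μ := by
  obtain ⟨A, hA, hAB⟩ := exists_isLowerSet_inter hs hB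
  exact (isLowerSet_measurableSet hA).nullMeasurableSet.congr (ae_eq_of_forall_mem hT hAB)

theorem integral_ite_eq_measureReal {μ : Measure ℝ} {p : ℝ → Prop} [DecidablePred p]
    (hp : NullMeasurableSet {x | p x} μ) :
    ∫ x, (if p x then (1 : ℝ) else 0) ∂μ = μ.real {x | p x} := by
  calc ∫ x, (if p x then (1 : ℝ) else 0) ∂μ =
        ∫ x, Set.indicator {x | p x} (fun _ => (1 : ℝ)) x ∂μ := by
        congr 1; ext x; simp [Set.indicator_apply]
    _ = _ := by rw [integral_indicator₀ hp]; simp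

/-- Each term of the expansion of `alloc` is a product of functions of single coordinates, so it
integrates to the product of the marginal probabilities. -/
theorem integral_alloc_update {n : ℕ} {μ : Fin n → Measure ℝ} [∀ i, IsProbabilityMeasure (μ i)]
    {s : Fin n → ℝ → ℝ} {b : ℝ} (hlt : ∀ j, NullMeasurableSet {x | s j x < b} (μ j))
    (heq : ∀ j, NullMeasurableSet {x | s j x = b} (μ j)) (i : Fin n) :
    ∫ x, alloc (Function.update (fun j => s j (x j)) i b) i ∂(Measure.pi μ) =
      ∑ S ∈ (Finset.univ.erase i).powerset, ((S.card : ℝ) + 1)⁻¹ *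
        ∏ j ∈ Finset.univ.erase i, tieFactor (fun j => (μ j).real {x | s j x < b})
          (fun j => (μ j).real {x | s j x = b}) S j := by
  classical
  -- The factor of bidder `i` is set to one so that the product runs over all coordinates of
  -- `Measure.pi μ`.
  set f : Finset (Fin n) → Fin n → ℝ → ℝ := fun S j x => if j = i then 1 else
    if j ∈ S then (if s j x = b then 1 else 0) else (if s j x < b then 1 else 0) with hf
  have hfi : ∀ S j, Integrable (f S j) (μ j) := by
    intro S j
    have key : ∀ p : ℝ → Prop, NullMeasurableSet {x | p x} (μ j) →
        Integrable (fun x => if p x then (1 : ℝ) else 0) (μ j) := by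
      intro p hp
      have : Integrable (Set.indicator {x | p x} (fun _ => (1 : ℝ))) (μ j) :=
        (integrable_const 1).indicator₀ hp
      refine this.congr (Filter.Eventually.of_forall fun x => ?_)
      simp [Set.indicator_apply]
    simp only [hf]
    split_ifs
    · exact integrable_const _
    · exact key _ (heq j)
    · exact key _ (hlt j)
  have h1 : ∀ x : Fin n → ℝ, alloc (Function.update (fun j => s j (x j)) i b) i =
      ∑ S ∈ (Finset.univ.erase i).powerset, ((S.card : ℝ) + 1)⁻¹ * ∏ j, f S j (x j) := by
    intro x
    rw [alloc_eq_sum_prod]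
    refine Finset.sum_congr rfl fun S _ => ?_
    congr 1
    rw [← Finset.mul_prod_erase _ _ (Finset.mem_univ i)]
    simp only [hf, if_true, one_mul]
    refine Finset.prod_congr rfl fun j hj => ?_
    have := Finset.ne_of_mem_erase hj
    simp [tieFactor, this]
  simp_rw [h1]
  rw [integral_finsetSum _ fun S _ => (Integrable.fintype_prod (hfi S)).const_mul _]
  refine Finset.sum_congr rfl fun S _ => ?_
  rw [integral_const_mul, integral_fintype_prod_eq_prod]
  congr 1
  rw [← Finset.mul_prod_erase _ _ (Finset.mem_univ i)]
  have : ∫ x, f S i x ∂μ i = 1 := by simp [hf]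
  rw [this, one_mul]
  refine Finset.prod_congr rfl fun j hj => ?_
  have := Finset.ne_of_mem_erase hj
  simp only [hf, this, if_false, tieFactor]
  split_ifs
  · exact integral_ite_eq_measureReal (heq j)
  · exact integral_ite_eq_measureReal (hlt j)

/-! ### Stability of utilities under changes of the bid distributions. -/

/-- All strategies of `P` induce, under `μ` and `ν`, bid distributions with Kolmogorov distance at
most `η`. -/
def BidsClose {n : ℕ} (P : Profile n) (η : ℝ) (μ ν : Fin n → Measure ℝ) : Prop :=
  ∀ (j : Fin n) (l : Fin (P.count j)) (B : Set ℝ), IsLowerSet B →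
    |(μ j).real {x | P.strat j l x ∈ B} - (ν j).real {x | P.strat j l x ∈ B}| ≤ η

theorem abs_winProb_sub_le {n : ℕ} {μ ν : Fin n → Measure ℝ} [∀ i, IsProbabilityMeasure (μ i)]
    [∀ i, IsProbabilityMeasure (ν i)] {P : Profile n} {H : ℝ} {T U V : Fin n → Set ℝ}
    (hP : P.IsValid H V) (hT : P.IsMonotone T) (hU : P.IsMonotone U)
    (hμ : ∀ i, ∀ᵐ x ∂(μ i), x ∈ T i) (hν : ∀ i, ∀ᵐ x ∂(ν i), x ∈ U i) {η : ℝ}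
    (hη : BidsClose P η μ ν) (i : Fin n) (b : ℝ) :
    |winProb μ P i b - winProb ν P i b| ≤ 3 * n * η := by
  have hw : ∀ l : (j : Fin n) → Fin (P.count j), 0 ≤ ∏ j, P.weight j (l j) := fun l =>
    Finset.prod_nonneg fun j _ => (hP.1 j (l j)).le
  have nm : ∀ {μ : Fin n → Measure ℝ} {T : Fin n → Set ℝ}, P.IsMonotone T →
      (∀ i, ∀ᵐ x ∂(μ i), x ∈ T i) → ∀ j l, NullMeasurableSet {x | P.strat j l x < b} (μ j) ∧
      NullMeasurableSet {x | P.strat j l x = b} (μ j) := by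
    intro μ T hT hμ j l
    have h1 := nullMeasurableSet_preimage (hμ j) (hT j l) (isLowerSet_Iio b)
    have h2 := nullMeasurableSet_preimage (hμ j) (hT j l) (isLowerSet_Iic b)
    refine ⟨h1, ?_⟩
    convert h2.diff h1 using 1
    ext x
    simp only [Set.mem_ofPred_eq, Set.mem_sdiff, Set.mem_Iic, Set.mem_Iio, not_lt]
    exact le_antisymm_iff
  have sub : ∀ {μ : Fin n → Measure ℝ} [∀ i, IsProbabilityMeasure (μ i)] {T : Fin n → Set ℝ},
      P.IsMonotone T → (∀ i, ∀ᵐ x ∂(μ i), x ∈ T i) → ∀ j l,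
      (μ j).real {x | P.strat j l x < b} + (μ j).real {x | P.strat j l x = b} =
        (μ j).real {x | P.strat j l x ∈ Set.Iic b} := by
    intro μ _ T hT hμ j l
    rw [← measureReal_union₀ (nm hT hμ j l).2 (Disjoint.aedisjoint ?_)]
    · congr 1; ext x; simp [le_iff_lt_or_eq]
    · rw [Set.disjoint_left]; intro x hx hx'; exact absurd hx' (ne_of_lt hx)
  have main : ∀ l : (j : Fin n) → Fin (P.count j),
      |∫ x, alloc (Function.update (fun j => P.strat j (l j) (x j)) i b) i ∂(Measure.pi μ) -
        ∫ x, alloc (Function.update (fun j => P.strat j (l j) (x j)) i b) i ∂(Measure.pi ν)| ≤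
        3 * n * η := by
    intro l
    rw [integral_alloc_update (s := fun j => P.strat j (l j)) (fun j => (nm hT hμ j (l j)).1)
        (fun j => (nm hT hμ j (l j)).2),
      integral_alloc_update (s := fun j => P.strat j (l j)) (fun j => (nm hU hν j (l j)).1)
        (fun j => (nm hU hν j (l j)).2), ← Finset.sum_sub_distrib]
    refine (Finset.abs_sum_le_sum_abs _ _).trans ?_
    refine le_trans (Finset.sum_le_sum (g := fun S => |∏ j ∈ Finset.univ.erase i,
      tieFactor (fun j => (μ j).real {x | P.strat j (l j) x < b})
          (fun j => (μ j).real {x | P.strat j (l j) x = b}) S j - ∏ j ∈ Finset.univ.erase i,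
      tieFactor (fun j => (ν j).real {x | P.strat j (l j) x < b})
          (fun j => (ν j).real {x | P.strat j (l j) x = b}) S j|) fun S _ => ?_) ?_
    · rw [← mul_sub, abs_mul]
      refine mul_le_of_le_one_left (abs_nonneg _) ?_
      rw [abs_of_nonneg (by positivity)]
      exact inv_le_one_of_one_le₀ (by linarith [(Nat.cast_nonneg S.card : (0 : ℝ) ≤ S.card)])
    · refine (sum_abs_prod_tieFactor_sub_le (fun _ => measureReal_nonneg)
        (fun _ => measureReal_nonneg) (fun j => ?_) (fun _ => measureReal_nonneg)
        (fun _ => measureReal_nonneg) (fun j => ?_) _).trans ?_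
      · rw [sub hT hμ]; exact measureReal_le_one
      · rw [sub hU hν]; exact measureReal_le_one
      · have h3 : ∀ j, |(μ j).real {x | P.strat j (l j) x < b} -
            (ν j).real {x | P.strat j (l j) x < b}| + |(μ j).real {x | P.strat j (l j) x = b} -
            (ν j).real {x | P.strat j (l j) x = b}| ≤ 3 * η := by
          intro j
          have h1 := abs_le.1 (hη j (l j) _ (isLowerSet_Iio b))
          have h2 := abs_le.1 (hη j (l j) _ (isLowerSet_Iic b))
          rw [← sub hT hμ, ← sub hU hν] at h2
          simp only [Set.mem_Iio] at h1
          have e1 := abs_le.2 h1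
          -- A tie at `b` has probability `P(bid ≤ b) - P(bid < b)`, which costs `2 * η`. With `η`
          -- for the strict inequality this makes `3 * η` per opponent.
          have e2 : |(μ j).real {x | P.strat j (l j) x = b} -
            (ν j).real {x | P.strat j (l j) x = b}| ≤ 2 * η :=
            abs_le.2 ⟨by linarith, by linarith⟩
          linarith
        have hη0 : 0 ≤ 3 * η := le_trans (by positivity) (h3 i)
        refine (Finset.sum_le_card_nsmul _ _ _ fun j _ => h3 j).trans ?_
        rw [nsmul_eq_mul]
        calc _ ≤ (n : ℝ) * (3 * η) := by
              gcongr
              exact_mod_cast (Finset.card_le_univ _).trans_eq (Fintype.card_fin n)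
          _ = _ := by ring
  unfold winProb
  rw [← Finset.sum_sub_distrib]
  refine (Finset.abs_sum_le_sum_abs _ _).trans ?_
  calc _ ≤ ∑ l : (j : Fin n) → Fin (P.count j), (∏ j, P.weight j (l j)) * (3 * n * η) := by
        refine Finset.sum_le_sum fun l _ => ?_
        rw [← mul_sub, abs_mul, abs_of_nonneg (hw l)]
        exact mul_le_mul_of_nonneg_left (main l) (hw l)
    _ = _ := by rw [← Finset.sum_mul, hP.sum_prod_weight, one_mul]

theorem abs_interimUtility_sub_le {n : ℕ} {μ ν : Fin n → Measure ℝ}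
    [∀ i, IsProbabilityMeasure (μ i)]
    [∀ i, IsProbabilityMeasure (ν i)] {P : Profile n} {H : ℝ} {T U V : Fin n → Set ℝ}
    (hP : P.IsValid H V) (hT : P.IsMonotone T) (hU : P.IsMonotone U)
    (hμ : ∀ i, ∀ᵐ x ∂(μ i), x ∈ T i) (hν : ∀ i, ∀ᵐ x ∂(ν i), x ∈ U i) {η : ℝ}
    (hη : BidsClose P η μ ν) (i : Fin n) {v b : ℝ} (hv : v ∈ Set.Icc 0 H) (hb : b ∈ Set.Icc 0 H) :
    |interimUtility μ P i v b - interimUtility ν P i v b| ≤ 3 * n * H * η := by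
  rw [interimUtility_eq, interimUtility_eq, ← mul_sub, abs_mul]
  have h1 := abs_winProb_sub_le hP hT hU hμ hν hη i b
  have h2 : |v - b| ≤ H := abs_le.2 ⟨by linarith [hv.1, hb.2], by linarith [hv.2, hb.1]⟩
  calc _ ≤ H * (3 * n * η) := mul_le_mul h2 h1 (abs_nonneg _) (hv.1.trans hv.2)
    _ = _ := by ring

/-! ### Uniform convergence of empirical distribution functions -/

theorem empirical_apply {n : ℕ} {m : ℕ} (ω : ℕ → Fin n → ℝ) (i : Fin n)
    (A : Set ℝ) : (empirical m ω i).real A =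
      (m : ℝ)⁻¹ * ∑ j ∈ Finset.range m, A.indicator (fun _ => (1 : ℝ)) (ω j i) := by
  classical
  unfold empirical
  simp only [measureReal_def, Measure.smul_apply, Measure.finsetSum_apply, smul_eq_mul,
    ENNReal.toReal_mul, ENNReal.toReal_inv, ENNReal.toReal_natCast]
  congr 1
  rw [ENNReal.toReal_sum]
  · refine Finset.sum_congr rfl fun j _ => ?_
    by_cases h : ω j i ∈ A <;> simp [h]
  · intro j _; exact measure_ne_top _ _

theorem isProbabilityMeasure_empirical {n m : ℕ} (hm : 0 < m) (ω : ℕ → Fin n → ℝ) (i : Fin n) :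
    IsProbabilityMeasure (empirical m ω i) := by
  constructor
  unfold empirical
  simp only [Measure.smul_apply, Measure.finsetSum_apply, measure_univ, smul_eq_mul,
    Finset.sum_const, Finset.card_range, nsmul_eq_mul, mul_one]
  exact ENNReal.inv_mul_cancel (by exact_mod_cast hm.ne') (ENNReal.natCast_ne_top m)

theorem ae_empirical {n m : ℕ} {ω : ℕ → Fin n → ℝ} {i : Fin n} {T : Set ℝ} (h : ∀ j, ω j i ∈ T) :
    ∀ᵐ x ∂(empirical m ω i), x ∈ T := by
  rw [ae_iff]
  simp [empirical, h]

instance {n : ℕ} (F : Fin n → Measure ℝ) [∀ i, IsProbabilityMeasure (F i)] :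
    IsProbabilityMeasure (sampleLaw F) := by
  unfold sampleLaw; infer_instance

theorem measurePreserving_sample {n : ℕ} (F : Fin n → Measure ℝ) [∀ i, IsProbabilityMeasure (F i)]
    (j : ℕ) (i : Fin n) : MeasurePreserving (fun ω : ℕ → Fin n → ℝ => ω j i) (sampleLaw F) (F i) :=
  (measurePreserving_eval F i).comp
    (measurePreserving_eval_infinitePi (fun _ : ℕ => Measure.pi F) j)

theorem ae_sample_mem {n : ℕ} (F : Fin n → Measure ℝ) [∀ i, IsProbabilityMeasure (F i)]
    {T : Fin n → Set ℝ} (hT : ∀ i, ∀ᵐ v ∂(F i), v ∈ T i) :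
    ∀ᵐ ω ∂(sampleLaw F), ∀ j i, ω j i ∈ T i := by
  rw [ae_all_iff]; intro j
  rw [ae_all_iff]; intro i
  exact (measurePreserving_sample F j i).quasiMeasurePreserving.ae (hT i)

/-- Hoeffding's inequality for the empirical frequency of an event. -/
theorem sampleLaw_empirical_ge_le {n : ℕ} (F : Fin n → Measure ℝ)
    [∀ i, IsProbabilityMeasure (F i)] (i : Fin n) {A : Set ℝ} (hA : MeasurableSet A) {m : ℕ}
    (hm : 0 < m) {η : ℝ} (hη : 0 ≤ η) :
    (sampleLaw F).real {ω | (F i).real A + η ≤ (empirical m ω i).real A} ≤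
      Real.exp (-(2 * m * η ^ 2)) := by
  have hm' : (0 : ℝ) < m := by exact_mod_cast hm
  set g : ℝ → ℝ := A.indicator fun _ => (1 : ℝ) with hg
  have hgm : Measurable g := measurable_const.indicator hA
  have hmean : ∀ j, ∫ ω, g (ω j i) ∂(sampleLaw F) = (F i).real A := by
    intro j
    rw [← integral_map (φ := fun ω : ℕ → Fin n → ℝ => ω j i) (f := g)
      (measurePreserving_sample F j i).aemeasurable hgm.aestronglyMeasurable,
      (measurePreserving_sample F j i).map_eq]
    exact integral_indicator_one hA
  have hind : ProbabilityTheory.iIndepFun (fun (j : ℕ) (ω : ℕ → Fin n → ℝ) =>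
      g (ω j i) - (F i).real A) (sampleLaw F) :=
    ProbabilityTheory.iIndepFun_infinitePi (X := fun (_ : ℕ) (x : Fin n → ℝ) =>
      g (x i) - (F i).real A) fun _ => (hgm.comp (measurable_pi_apply i)).sub_const _
  have hsub : ∀ j < m, ProbabilityTheory.HasSubgaussianMGF
      (fun ω : ℕ → Fin n → ℝ => g (ω j i) - (F i).real A) ((‖(1 : ℝ) - 0‖₊ / 2) ^ 2)
      (sampleLaw F) := by
    intro j _
    have := ProbabilityTheory.hasSubgaussianMGF_of_mem_Icc (μ := sampleLaw F)
      (X := fun ω : ℕ → Fin n → ℝ => g (ω j i)) (a := 0) (b := 1)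
      (hgm.comp (measurePreserving_sample F j i).measurable).aemeasurable
      (Filter.Eventually.of_forall fun ω => by
        by_cases h : ω j i ∈ A <;> simp [hg, h])
    rwa [hmean j] at this
  have := ProbabilityTheory.HasSubgaussianMGF.measure_sum_range_ge_le_of_iIndepFun hind hsub
    (ε := m * η) (by positivity)
  convert this using 1
  · congr 1
    ext ω
    simp only [Set.mem_ofPred_eq]
    rw [empirical_apply, Finset.sum_sub_distrib, inv_mul_eq_div, le_div_iff₀ hm']
    simp only [Finset.sum_const, Finset.card_range, nsmul_eq_mul]
    constructor <;> intro h <;> linarith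
  · congr 1
    simp
    field_simp

/-! ### Bracketing of lower sets and the union bound. -/

/-- The set of all `x` with `μ (Iic x) ≤ c` contains every competitor. Its own measure is at most
`c` by inner regularity: a nonempty compact subset has a greatest element `x` and lies in `Iic x`.
Atoms and open or closed endpoints need no case distinction. -/
theorem exists_isLowerSet_max (μ : Measure ℝ) [IsProbabilityMeasure μ] {c : ℝ} (hc : 0 ≤ c) :
    ∃ L, IsLowerSet L ∧ μ.real L ≤ c ∧ ∀ A, IsLowerSet A → μ.real A ≤ c → A ⊆ L := by
  have hL : IsLowerSet {x | μ.real (Set.Iic x) ≤ c} := fun x y hyx hx =>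
    (measureReal_mono (Set.Iic_subset_Iic.2 hyx)).trans hx
  refine ⟨{x | μ.real (Set.Iic x) ≤ c}, hL, ?_, fun A hA hAc x hx => ?_⟩
  · rw [measureReal_def]
    refine ENNReal.toReal_le_of_le_ofReal hc ?_
    rw [(isLowerSet_measurableSet hL).measure_eq_iSup_isCompact]
    refine iSup₂_le fun K hK => iSup_le fun hKc => ?_
    rcases K.eq_empty_or_nonempty with rfl | hne
    · simp
    · obtain ⟨x, hx, hmax⟩ := hKc.exists_isGreatest hne
      have hKx : K ⊆ Set.Iic x := fun y hy => hmax hy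
      refine (measure_mono hKx).trans ?_
      rw [← ofReal_measureReal]
      exact ENNReal.ofReal_le_ofReal (hK hx)
  · exact (measureReal_mono fun y hy => hA hy hx).trans hAc

/-- Dual to `exists_isLowerSet_max`: inner regularity is applied to the complement, whose nonempty
compact subsets have a least element. -/
theorem exists_isLowerSet_min (μ : Measure ℝ) [IsProbabilityMeasure μ] {c : ℝ} (hc : c ≤ 1) :
    ∃ U, IsLowerSet U ∧ c ≤ μ.real U ∧ ∀ A, IsLowerSet A → c ≤ μ.real A → U ⊆ A := by
  have hU : IsLowerSet {x | μ.real (Set.Iio x) < c} := fun x y hyx hx =>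
    (measureReal_mono (Set.Iio_subset_Iio hyx)).trans_lt hx
  have hUm := isLowerSet_measurableSet hU
  refine ⟨{x | μ.real (Set.Iio x) < c}, hU, ?_, fun A hA hAc x hx => ?_⟩
  · have h1 : μ.real {x | μ.real (Set.Iio x) < c}ᶜ ≤ 1 - c := by
      rw [measureReal_def]
      refine ENNReal.toReal_le_of_le_ofReal (by linarith) ?_
      rw [hUm.compl.measure_eq_iSup_isCompact]
      refine iSup₂_le fun K hK => iSup_le fun hKc => ?_
      rcases K.eq_empty_or_nonempty with rfl | hne
      · simp
      · obtain ⟨x, hx, hmin⟩ := hKc.exists_isLeast hne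
        have hKx : K ⊆ Set.Ici x := fun y hy => hmin hy
        refine (measure_mono hKx).trans ?_
        rw [← ofReal_measureReal, ← Set.compl_Iio, probReal_compl_eq_one_sub measurableSet_Iio]
        have : c ≤ μ.real (Set.Iio x) := not_lt.1 (hK hx)
        exact ENNReal.ofReal_le_ofReal (by linarith)
    rw [probReal_compl_eq_one_sub hUm] at h1
    linarith
  · by_contra hxA
    have : A ⊆ Set.Iio x := fun y hy => lt_of_not_ge fun h => hxA (hA h hy)
    exact absurd (hAc.trans (measureReal_mono this)) (not_le.2 hx)

/-- The empirical distribution functions of all bidders are uniformly `η`-close to the true ones. -/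
def UniformlyClose {n : ℕ} (F : Fin n → Measure ℝ) (m : ℕ) (η : ℝ) (ω : ℕ → Fin n → ℝ) : Prop :=
  ∀ (i : Fin n) (A : Set ℝ), IsLowerSet A → |(F i).real A - (empirical m ω i).real A| ≤ η

/-- A lower set of probability between `r / k` and `(r + 1) / k` lies between the minimal lower set
at the first level and the maximal one at the second. The bracket and Hoeffding's inequality cost `1
/ k` each. There are `n` bidders, `k + 1` levels and two one-sided events for each. -/
theorem sampleLaw_not_uniformlyClose_le_exp {n : ℕ} (F : Fin n → Measure ℝ)
    [∀ i, IsProbabilityMeasure (F i)] {k m : ℕ} (hk : 0 < k) (hm : 0 < m) :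
    sampleLaw F {ω | ¬ UniformlyClose F m (2 / k) ω} ≤
      ENNReal.ofReal (2 * n * (k + 1) * Real.exp (-(2 * m * (1 / (k : ℝ)) ^ 2))) := by
  have hk' : (0 : ℝ) < k := by exact_mod_cast hk
  have hL : ∀ (i : Fin n) (r : Fin (k + 1)), ∃ L, IsLowerSet L ∧
      (F i).real L ≤ ((r : ℝ) + 1) / k ∧
      ∀ A, IsLowerSet A → (F i).real A ≤ ((r : ℝ) + 1) / k → A ⊆ L := fun i r =>
    exists_isLowerSet_max (F i) (by positivity)
  have hU : ∀ (i : Fin n) (r : Fin (k + 1)), ∃ U, IsLowerSet U ∧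
      (r : ℝ) / k ≤ (F i).real U ∧
      ∀ A, IsLowerSet A → (r : ℝ) / k ≤ (F i).real A → U ⊆ A := fun i r =>
    exists_isLowerSet_min (F i) (by
      rw [div_le_one hk']; exact_mod_cast Nat.lt_succ_iff.1 r.2)
  choose L hL1 hL2 hL3 using hL
  choose U hU1 hU2 hU3 using hU
  -- Complements of the lower brackets turn the required lower deviations into upper ones.
  set B : Fin n × Fin (k + 1) × Bool → Set ℝ := fun q =>
    if q.2.2 then L q.1 q.2.1 else (U q.1 q.2.1)ᶜ with hB
  have hBm : ∀ q, MeasurableSet (B q) := by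
    intro q; simp only [hB]; split_ifs
    · exact isLowerSet_measurableSet (hL1 _ _)
    · exact (isLowerSet_measurableSet (hU1 _ _)).compl
  have hsub : {ω | ¬ UniformlyClose F m (2 / k) ω} ⊆
      ⋃ q, {ω | (F q.1).real (B q) + 1 / k ≤ (empirical m ω q.1).real (B q)} := by
    intro ω hω
    by_contra hcon
    simp only [Set.mem_iUnion, Set.mem_ofPred_eq, not_exists, not_le] at hcon
    refine hω fun i A hA => ?_
    have := isProbabilityMeasure_empirical hm ω i
    set p := (F i).real A with hp
    have hp0 : 0 ≤ p := measureReal_nonneg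
    have hp1 : p ≤ 1 := measureReal_le_one
    -- The level is the floor of `p * k`; it equals `k` when `p = 1`, hence `k + 1` levels.
    have hr : ⌊p * k⌋₊ < k + 1 := by
      rw [Nat.lt_succ_iff]
      refine Nat.floor_le_of_le ?_
      exact mul_le_of_le_one_left hk'.le hp1
    have hr1 : (⌊p * k⌋₊ : ℝ) / k ≤ p := by
      rw [div_le_iff₀ hk']; exact Nat.floor_le (by positivity)
    have hr2 : p ≤ ((⌊p * k⌋₊ : ℝ) + 1) / k := by
      rw [le_div_iff₀ hk']; exact (Nat.lt_floor_add_one _).le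
    have c1 := hcon (i, ⟨_, hr⟩, true)
    have c2 := hcon (i, ⟨_, hr⟩, false)
    simp only [hB, if_true, Bool.false_eq_true, if_false] at c1 c2
    have s1 : A ⊆ L i ⟨_, hr⟩ := hL3 i ⟨_, hr⟩ A hA hr2
    have s2 : U i ⟨_, hr⟩ ⊆ A := hU3 i ⟨_, hr⟩ A hA hr1
    have m1 := measureReal_mono (μ := empirical m ω i) s1
    have m2 := measureReal_mono (μ := empirical m ω i) s2
    rw [probReal_compl_eq_one_sub (isLowerSet_measurableSet (hU1 _ _)),
      probReal_compl_eq_one_sub (isLowerSet_measurableSet (hU1 _ _))] at c2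
    have d1 := hL2 i ⟨_, hr⟩
    have d2 := hU2 i ⟨_, hr⟩
    simp only at d1 d2
    have e : ((⌊p * k⌋₊ : ℝ) + 1) / k = (⌊p * k⌋₊ : ℝ) / k + 1 / k := by ring
    have e2 : (2 : ℝ) / k = 1 / k + 1 / k := by ring
    rw [abs_le, e2]
    constructor <;> linarith
  refine (measure_mono hsub).trans ((measure_iUnion_fintype_le _ _).trans ?_)
  calc _ ≤ ∑ q : Fin n × Fin (k + 1) × Bool,
        ENNReal.ofReal (Real.exp (-(2 * m * (1 / (k : ℝ)) ^ 2))) := by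
        refine Finset.sum_le_sum fun q _ => ?_
        rw [← ofReal_measureReal]
        exact ENNReal.ofReal_le_ofReal
          (sampleLaw_empirical_ge_le F q.1 (hBm q) hm (by positivity))
    _ = _ := by
        rw [← ENNReal.ofReal_sum_of_nonneg fun _ _ => (Real.exp_pos _).le]
        congr 1
        simp
        ring

/-- The number `a` of events in the union bound is absorbed by `a ≤ exp a`. This wasteful estimate
keeps the sample size a polynomial in `k` and `Λ` without further logarithms, so that the machine
can compute it. -/
theorem sampleLaw_not_uniformlyClose_le {n : ℕ} (F : Fin n → Measure ℝ)
    [∀ i, IsProbabilityMeasure (F i)] {k m : ℕ} (hk : 0 < k) (hm : 0 < m) {δ Λ : ℝ} (hδ : 0 < δ)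
    (hΛ : Real.log (1 / δ) ≤ Λ) (hmk : (k : ℝ) ^ 2 * (2 * n * (k + 1) + Λ) ≤ m) :
    sampleLaw F {ω | ¬ UniformlyClose F m (2 / k) ω} ≤ ENNReal.ofReal δ := by
  have hk' : (0 : ℝ) < k := by exact_mod_cast hk
  refine (sampleLaw_not_uniformlyClose_le_exp F hk hm).trans (ENNReal.ofReal_le_ofReal ?_)
  set a : ℝ := 2 * n * (k + 1) with ha
  have h1 : a + Λ ≤ 2 * m * (1 / (k : ℝ)) ^ 2 := by
    have : a + Λ ≤ m / (k : ℝ) ^ 2 := by rw [le_div_iff₀ (by positivity)]; linarith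
    have h0 : (0 : ℝ) ≤ m / (k : ℝ) ^ 2 := by positivity
    calc _ ≤ m / (k : ℝ) ^ 2 := this
      _ ≤ 2 * (m / (k : ℝ) ^ 2) := by linarith
      _ = _ := by field_simp
  calc a * Real.exp (-(2 * m * (1 / (k : ℝ)) ^ 2)) ≤ Real.exp a * Real.exp (-(a + Λ)) := by
        have := Real.add_one_le_exp a
        gcongr
        linarith
    _ = Real.exp (-Λ) := by rw [← Real.exp_add]; ring_nf
    _ ≤ Real.exp (Real.log δ) := by
        rw [Real.exp_le_exp, one_div, Real.log_inv] at *; linarith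
    _ = δ := Real.exp_log hδ

/-! ### Transfer of equilibria -/

/-- The closeness of the samples does not mention `P`, so one good event serves all monotone
profiles simultaneously. -/
theorem bidsClose_of_uniformlyClose {n : ℕ} {F : Fin n → Measure ℝ} {P : Profile n}
    {T : Fin n → Set ℝ} (hP : P.IsMonotone T) (hF : ∀ i, ∀ᵐ x ∂(F i), x ∈ T i) {m : ℕ} {η : ℝ}
    {ω : ℕ → Fin n → ℝ} (hω : ∀ j i, ω j i ∈ T i) (h : UniformlyClose F m η ω) :
    BidsClose P η F (empirical m ω) := by
  intro j l B hB
  obtain ⟨A, hA, hAB⟩ := exists_isLowerSet_inter (hP j l) hB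
  have h1 : (F j).real {x | P.strat j l x ∈ B} = (F j).real A :=
    (measureReal_congr (ae_eq_of_forall_mem (hF j) hAB)).symm
  have h2 : (empirical m ω j).real {x | P.strat j l x ∈ B} = (empirical m ω j).real A :=
    (measureReal_congr (ae_eq_of_forall_mem (ae_empirical fun r => hω r j) hAB)).symm
  rw [h1, h2]
  exact h j A hA

/-- One `e` is lost on the deviation and one on the equilibrium payoff; the latter is an average
with weights of total mass one. -/
theorem IsBNE.of_abs_interimUtility_sub_le {n : ℕ} {H ε' e : ℝ} {μ ν : Fin n → Measure ℝ}
    {T : Fin n → Set ℝ} {P : Profile n} (hP : P.IsValid H T)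
    (h : ∀ i, ∀ v ∈ T i, ∀ b ∈ Set.Icc 0 H,
      |interimUtility μ P i v b - interimUtility ν P i v b| ≤ e)
    (hν : IsBNE H ε' ν T P) : IsBNE H (ε' + 2 * e) μ T P := by
  intro i v hv b hb
  have h1 := abs_le.1 (h i v hv b hb)
  have h2 := hν i v hv b hb
  have h3 : ∑ l, P.weight i l * interimUtility ν P i v (P.strat i l v) - e ≤
      ∑ l, P.weight i l * interimUtility μ P i v (P.strat i l v) := by
    calc _ = ∑ l, P.weight i l * (interimUtility ν P i v (P.strat i l v) - e) := by
          simp_rw [mul_sub]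
          rw [Finset.sum_sub_distrib, ← Finset.sum_mul, hP.2.1 i, one_mul]
      _ ≤ _ := by
          refine Finset.sum_le_sum fun l _ => mul_le_mul_of_nonneg_left ?_ (hP.1 i l).le
          have := abs_le.1 (h i v hv _ (hP.2.2 i l v hv))
          linarith
  linarith

theorem IsBNE.mono {n : ℕ} {H ε₁ ε₂ : ℝ} {μ : Fin n → Measure ℝ} {T : Fin n → Set ℝ}
    {P : Profile n} (h : IsBNE H ε₁ μ T P) (hε : ε₁ ≤ ε₂) : IsBNE H ε₂ μ T P :=
  fun i v hv b hb => by linarith [h i v hv b hb]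

theorem empiricalEquilibriaTransfer (n : ℕ) {H : ℝ} (hH : 0 < H) :
    EmpiricalEquilibriaTransfer n H := by
  -- Chosen such that `k ≤ a * Q` for the number `k` of levels below; the `2` pays for the ceiling
  -- and the `+ 1` in `k`.
  set a : ℕ := ⌈12 * n * H⌉₊ + 2 with ha
  have ha' : 12 * n * H + 2 ≤ (a : ℝ) := by
    have := Nat.le_ceil (12 * n * H)
    rw [ha]; push_cast; linarith
  refine ⟨a ^ 2 * (2 * n * (a + 1) + 1), 3, fun ε δ hε hδ hδ1 m hm T F _ hTH hT => ?_⟩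
  set Λ := Real.log (1 / δ) with hΛ
  have hΛ0 : 0 ≤ Λ := Real.log_nonneg (by rw [le_div_iff₀ hδ]; linarith)
  set Q := 1 + 1 / ε + Λ with hQ
  have hε' : 0 < 1 / ε := by positivity
  have hQ1 : 1 ≤ Q := by linarith
  -- With `η = 2 / k` the loss is `2 * (3 * n * H * η) = 12 * n * H / k ≤ ε`.
  set k : ℕ := ⌈12 * n * H / ε⌉₊ + 1 with hk
  have hk0 : (0 : ℝ) < k := by rw [hk]; positivity
  have hk1 : 12 * n * H ≤ ε * k := by
    have := Nat.le_ceil (12 * n * H / ε)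
    rw [div_le_iff₀ hε] at this
    rw [hk]; push_cast; linarith
  have hk2 : (k : ℝ) ≤ a * Q := by
    have h1 := Nat.ceil_lt_add_one (show 0 ≤ 12 * n * H / ε by positivity)
    have h2 : (k : ℝ) ≤ 12 * n * H * (1 / ε) + 2 := by
      rw [hk]; push_cast
      have : 12 * n * H / ε = 12 * n * H * (1 / ε) := by ring
      linarith
    have h0 : 0 ≤ 12 * n * H := by positivity
    nlinarith
  have hmk : (k : ℝ) ^ 2 * (2 * n * (k + 1) + Λ) ≤ m := by
    refine le_trans ?_ hm
    calc (k : ℝ) ^ 2 * (2 * n * (k + 1) + Λ) ≤ (a * Q) ^ 2 * (2 * n * (a * Q + Q) + Q) := by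
          gcongr; linarith
      _ = _ := by push_cast; ring
  have hm0 : 0 < m := by
    have : (0 : ℝ) < m := by
      refine lt_of_lt_of_le ?_ hm
      have : (0 : ℝ) < a := by rw [ha]; positivity
      push_cast; positivity
    exact_mod_cast this
  refine le_trans (measure_mono_ae ?_) (sampleLaw_not_uniformlyClose_le F (k := k) (m := m)
    (by exact_mod_cast hk0) hm0 hδ le_rfl hmk)
  filter_upwards [ae_sample_mem F hT] with ω hω
  rintro ⟨P, ε', -, ⟨hκ, hP, hmon, hbne⟩, hnot⟩ hclose
  have := fun i => isProbabilityMeasure_empirical hm0 ω i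
  refine hnot ⟨hκ, hP, hmon, ?_⟩
  have key := IsBNE.of_abs_interimUtility_sub_le hP (μ := F) (e := 3 * n * H * (2 / k))
    (fun i v hv b hb => abs_interimUtility_sub_le hP hmon hmon hT
      (fun i => ae_empirical fun j => hω j i)
      (bidsClose_of_uniformlyClose hmon hT hω hclose) i (hTH i hv) hb) hbne
  refine key.mono ?_
  have : 2 * (3 * n * H * (2 / k)) = 12 * n * H / k := by ring
  rw [this]
  have : 12 * n * H / k ≤ ε := by rw [div_le_iff₀ hk0]; exact hk1
  linarith

/-! ### Executions -/

/-- All arrays that occur in the expression have an index below this number. -/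
def NatExp.arrays : NatExp → ℕ
  | const _ => 0
  | cell a i => max (a + 1) i.arrays
  | add e f => max e.arrays f.arrays
  | sub e f => max e.arrays f.arrays

/-- All arrays that occur in the expression have an index below this number. -/
def RealExp.arrays : RealExp → ℕ
  | ofNat e => e.arrays
  | cell a i j k => max (a + 1) (max i.arrays (max j.arrays k.arrays))
  | add e f => max e.arrays f.arrays
  | sub e f => max e.arrays f.arrays
  | mul e f => max e.arrays f.arrays
  | div e f => max e.arrays f.arrays

/-- All arrays that occur in the test have an index below this number. -/
def Test.arrays : Test → ℕ
  | natLt e f => max e.arrays f.arrays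
  | realLt e f => max e.arrays f.arrays
  | not p => p.arrays
  | and p q => max p.arrays q.arrays

/-- All arrays that occur in the program have an index below this number. -/
def Cmd.arrays : Cmd → ℕ
  | skip => 0
  | setNat a i e => max (a + 1) (max i.arrays e.arrays)
  | setReal a i j k e => max (a + 1) (max (max i.arrays (max j.arrays k.arrays)) e.arrays)
  | draw a i j k e => max (a + 1) (max (max i.arrays (max j.arrays k.arrays)) e.arrays)
  | seq c d => max c.arrays d.arrays
  | ite p c d => max p.arrays (max c.arrays d.arrays)
  | loop p c => max p.arrays c.arrays

/-- The states agree on the arrays below `N`. -/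
def AgreeBelow (N : ℕ) (σ τ : State) : Prop :=
  (∀ a < N, σ.nat a = τ.nat a) ∧ ∀ a < N, σ.real a = τ.real a

/-- The states agree on the arrays from `N` on. -/
def AgreeFrom (N : ℕ) (σ τ : State) : Prop :=
  (∀ a, N ≤ a → σ.nat a = τ.nat a) ∧ ∀ a, N ≤ a → σ.real a = τ.real a

theorem AgreeFrom.trans {N : ℕ} {σ τ ρ : State} (h : AgreeFrom N σ τ) (h' : AgreeFrom N τ ρ) :
    AgreeFrom N σ ρ :=
  ⟨fun a ha => (h.1 a ha).trans (h'.1 a ha), fun a ha => (h.2 a ha).trans (h'.2 a ha)⟩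

theorem NatExp.eval_congr {N : ℕ} {σ τ : State} (h : AgreeBelow N σ τ) {e : NatExp}
    (he : e.arrays ≤ N) : e.eval σ = e.eval τ := by
  induction e with
  | const k => rfl
  | cell a i ih =>
    simp only [arrays, max_le_iff] at he
    simp only [eval, ih he.2, h.1 a he.1]
  | add e f ihe ihf | sub e f ihe ihf =>
    simp only [arrays, max_le_iff] at he
    simp only [eval, ihe he.1, ihf he.2]

theorem RealExp.eval_congr {N : ℕ} {σ τ : State} (h : AgreeBelow N σ τ) {e : RealExp}
    (he : e.arrays ≤ N) : e.eval σ = e.eval τ := by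
  induction e with
  | ofNat e => simp only [eval, NatExp.eval_congr h he]
  | cell a i j k =>
    simp only [arrays, max_le_iff] at he
    simp only [eval, NatExp.eval_congr h he.2.1, NatExp.eval_congr h he.2.2.1,
      NatExp.eval_congr h he.2.2.2, h.2 a he.1]
  | add e f ihe ihf | sub e f ihe ihf | mul e f ihe ihf | div e f ihe ihf =>
    simp only [arrays, max_le_iff] at he
    simp only [eval, ihe he.1, ihf he.2]

theorem Test.holds_congr {N : ℕ} {σ τ : State} (h : AgreeBelow N σ τ) {p : Test}
    (hp : p.arrays ≤ N) : p.Holds σ ↔ p.Holds τ := by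
  induction p with
  | natLt e f =>
    simp only [arrays, max_le_iff] at hp
    simp only [Holds, NatExp.eval_congr h hp.1, NatExp.eval_congr h hp.2]
  | realLt e f =>
    simp only [arrays, max_le_iff] at hp
    simp only [Holds, RealExp.eval_congr h hp.1, RealExp.eval_congr h hp.2]
  | not p ih => simp only [Holds, ih hp]
  | and p q ihp ihq =>
    simp only [arrays, max_le_iff] at hp
    simp only [Holds, ihp hp.1, ihq hp.2]

/-- A program without samples that uses only the arrays below `N` behaves in the same way on states
that agree on these arrays, whatever the samples, and does not change the other arrays. -/
theorem Exec.simulate {S S' : ℕ → ℕ → ℝ} {N : ℕ} {c : Cmd} {σ σ' : State} {t : ℕ}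
    (h : Exec S c σ σ' t) (hc : c.DrawFree) (hN : c.arrays ≤ N) {τ : State}
    (hτ : AgreeBelow N σ τ) :
    ∃ τ', Exec S' c τ τ' t ∧ AgreeBelow N σ' τ' ∧ AgreeFrom N τ τ' := by
  have hrefl : ∀ τ, AgreeFrom N τ τ := fun τ => ⟨fun _ _ => rfl, fun _ _ => rfl⟩
  induction h generalizing τ with
  | skip σ => exact ⟨τ, .skip τ, hτ, hrefl τ⟩
  | setNat σ a i e =>
    simp only [Cmd.arrays, max_le_iff] at hN
    refine ⟨_, .setNat τ a i e, ?_, ?_⟩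
    · rw [NatExp.eval_congr hτ hN.2.1, NatExp.eval_congr hτ hN.2.2]
      refine ⟨fun a' ha' => ?_, hτ.2⟩
      funext i'
      simp only [State.setNat, hτ.1 a' ha']
    · refine ⟨fun a' ha' => ?_, fun _ _ => rfl⟩
      have : a' ≠ a := by omega
      funext i'; simp [State.setNat, this]
  | setReal σ a i j k e =>
    simp only [Cmd.arrays, max_le_iff] at hN
    refine ⟨_, .setReal τ a i j k e, ?_, ?_⟩
    · rw [NatExp.eval_congr hτ hN.2.1.1, NatExp.eval_congr hτ hN.2.1.2.1,
        NatExp.eval_congr hτ hN.2.1.2.2, RealExp.eval_congr hτ hN.2.2]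
      refine ⟨hτ.1, fun a' ha' => ?_⟩
      funext i' j' k'
      simp only [State.setReal, hτ.2 a' ha']
    · refine ⟨fun _ _ => rfl, fun a' ha' => ?_⟩
      have : a' ≠ a := by omega
      funext i' j' k'; simp [State.setReal, this]
  | draw => exact hc.elim
  | seq _ _ ih₁ ih₂ =>
    simp only [Cmd.arrays, max_le_iff] at hN
    obtain ⟨τ₂, h1, h2, h3⟩ := ih₁ hc.1 hN.1 hτ
    obtain ⟨τ₃, h4, h5, h6⟩ := ih₂ hc.2 hN.2 h2
    exact ⟨τ₃, .seq h1 h4, h5, h3.trans h6⟩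
  | ite_true hp _ ih =>
    simp only [Cmd.arrays, max_le_iff] at hN
    obtain ⟨τ₂, h1, h2, h3⟩ := ih hc.1 hN.2.1 hτ
    exact ⟨τ₂, .ite_true ((Test.holds_congr hτ hN.1).1 hp) h1, h2, h3⟩
  | ite_false hp _ ih =>
    simp only [Cmd.arrays, max_le_iff] at hN
    obtain ⟨τ₂, h1, h2, h3⟩ := ih hc.2 hN.2.2 hτ
    exact ⟨τ₂, .ite_false (fun h => hp ((Test.holds_congr hτ hN.1).2 h)) h1, h2, h3⟩
  | loop_stop hp =>
    simp only [Cmd.arrays, max_le_iff] at hN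
    exact ⟨τ, Exec.loop_stop fun h => hp ((Test.holds_congr hτ hN.1).2 h), hτ, hrefl τ⟩
  | loop_step hp _ _ ih₁ ih₂ =>
    have hN' := hN
    simp only [Cmd.arrays, max_le_iff] at hN
    obtain ⟨τ₂, h1, h2, h3⟩ := ih₁ hc hN.2 hτ
    obtain ⟨τ₃, h4, h5, h6⟩ := ih₂ hc hN' h2
    exact ⟨τ₃, .loop_step ((Test.holds_congr hτ hN.1).1 hp) h1 h4, h5, h3.trans h6⟩

/-! ### Time bounds and loop invariants. -/

/-- Started in `σ`, the program `c` halts in `σ'` after at most `T` steps. -/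
def Within (S : ℕ → ℕ → ℝ) (c : Cmd) (σ σ' : State) (T : ℕ) : Prop :=
  ∃ t ≤ T, Exec S c σ σ' t

section Within

variable {S : ℕ → ℕ → ℝ} {c d : Cmd} {σ σ' σ₁ σ₂ σ₃ : State} {T U : ℕ}

theorem Within.mono (h : Within S c σ σ' T) (hTU : T ≤ U) : Within S c σ σ' U :=
  let ⟨t, ht, he⟩ := h; ⟨t, ht.trans hTU, he⟩

theorem Within.seq (hc : Within S c σ₁ σ₂ T) (hd : Within S d σ₂ σ₃ U) :
    Within S (.seq c d) σ₁ σ₃ (T + U) :=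
  let ⟨t, ht, hc⟩ := hc; let ⟨u, hu, hd⟩ := hd; ⟨t + u, add_le_add ht hu, .seq hc hd⟩

theorem within_setNat {a : ℕ} {i e : NatExp} (h : σ.setNat a (i.eval σ) (e.eval σ) = σ') :
    Within S (.setNat a i e) σ σ' 1 := h ▸ ⟨1, le_rfl, .setNat σ a i e⟩

theorem within_setReal {a : ℕ} {i j k : NatExp} {e : RealExp}
    (h : σ.setReal a (i.eval σ) (j.eval σ) (k.eval σ) (e.eval σ) = σ') :
    Within S (.setReal a i j k e) σ σ' 1 := h ▸ ⟨1, le_rfl, .setReal σ a i j k e⟩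

theorem within_draw {a : ℕ} {i j k e : NatExp}
    (h : (σ.setReal a (i.eval σ) (j.eval σ) (k.eval σ)
      (S (σ.drawn (e.eval σ)) (e.eval σ))).countDraw (e.eval σ) = σ') :
    Within S (.draw a i j k e) σ σ' 1 := h ▸ ⟨1, le_rfl, .draw σ a i j k e⟩

theorem within_loop {p : Test} {st : ℕ → State} {M : ℕ} (hp : ∀ k < M, p.Holds (st k))
    (hc : ∀ k < M, Within S c (st k) (st (k + 1)) T) (hM : ¬ p.Holds (st M)) :
    Within S (.loop p c) (st 0) (st M) (M * (T + 1) + 1) := by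
  -- Induction on the number `r` of remaining rounds, since an execution of a loop is built from its
  -- end.
  have key : ∀ r ≤ M, Within S (.loop p c) (st (M - r)) (st M) (r * (T + 1) + 1) := by
    intro r
    induction r with
    | zero => exact fun _ => ⟨1, by omega, Exec.loop_stop hM⟩
    | succ r ih =>
      intro hr
      obtain ⟨t, ht, h1⟩ := hc (M - (r + 1)) (by omega)
      obtain ⟨u, hu, h2⟩ := ih (by omega)
      rw [show M - (r + 1) + 1 = M - r by omega] at h1
      refine ⟨t + u + 1, ?_, .loop_step (hp _ (by omega)) h1 h2⟩
      rw [add_mul]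
      omega
  simpa using key M le_rfl

end Within

/-! ### Registers -/

/-- The state whose arrays `N` hold the registers `v` (natural numbers) and `w` (reals), and which
agrees with `σ` elsewhere. -/
def overlay (N : ℕ) (v : ℕ → ℕ) (w : ℕ → ℝ) (σ : State) : State where
  nat a i := if a = N then v i else σ.nat a i
  real a i j k := if a = N then (if j = 0 ∧ k = 0 then w i else 0) else σ.real a i j k
  drawn := σ.drawn

theorem State.ext' {σ τ : State} (h1 : ∀ a i, σ.nat a i = τ.nat a i)
    (h2 : ∀ a i j k, σ.real a i j k = τ.real a i j k) (h3 : ∀ e, σ.drawn e = τ.drawn e) :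
    σ = τ := by
  obtain ⟨f, g, d⟩ := σ
  obtain ⟨f', g', d'⟩ := τ
  have e1 : f = f' := by funext a i; exact h1 a i
  have e2 : g = g' := by funext a i j k; exact h2 a i j k
  have e3 : d = d' := by funext e; exact h3 e
  rw [e1, e2, e3]

section overlay

variable {N : ℕ} {v : ℕ → ℕ} {w : ℕ → ℝ} {σ : State} {a i j k r x : ℕ} {y : ℝ}

theorem overlay_nat_self : (overlay N v w σ).nat N r = v r := by simp [overlay]

theorem overlay_real_self : (overlay N v w σ).real N r 0 0 = w r := by simp [overlay]

theorem overlay_nat_ne (h : a ≠ N) : (overlay N v w σ).nat a i = σ.nat a i := by simp [overlay, h]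

theorem overlay_real_ne (h : a ≠ N) : (overlay N v w σ).real a i j k = σ.real a i j k := by
  simp [overlay, h]

theorem overlay_setNat_self :
    (overlay N v w σ).setNat N r x = overlay N (Function.update v r x) w σ := by
  refine State.ext' (fun a i => ?_) (fun _ _ _ _ => rfl) fun _ => rfl
  simp only [State.setNat, overlay, Function.update_apply]
  split_ifs <;> simp_all

theorem overlay_setNat_ne (h : a ≠ N) :
    (overlay N v w σ).setNat a i x = overlay N v w (σ.setNat a i x) := by
  refine State.ext' (fun a' i' => ?_) (fun _ _ _ _ => rfl) fun _ => rfl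
  simp only [State.setNat, overlay]
  split_ifs <;> simp_all

theorem overlay_setReal_self :
    (overlay N v w σ).setReal N r 0 0 y = overlay N v (Function.update w r y) σ := by
  refine State.ext' (fun _ _ => rfl) (fun a i j k => ?_) fun _ => rfl
  simp only [State.setReal, overlay, Function.update_apply]
  split_ifs <;> simp_all

theorem overlay_setReal_ne (h : a ≠ N) :
    (overlay N v w σ).setReal a i j k y = overlay N v w (σ.setReal a i j k y) := by
  refine State.ext' (fun _ _ => rfl) (fun a' i' j' k' => ?_) fun _ => rfl
  simp only [State.setReal, overlay]
  split_ifs <;> simp_all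

theorem overlay_eq_self (hv : σ.nat N = v)
    (hw : ∀ i j k, σ.real N i j k = if j = 0 ∧ k = 0 then w i else 0) : overlay N v w σ = σ := by
  refine State.ext' (fun a i => ?_) (fun a i j k => ?_) fun _ => rfl
  · simp only [overlay]; split_ifs with h
    · rw [h, hv]
    · rfl
  · by_cases h : a = N
    · rw [h, hw]; simp [overlay]
    · simp [overlay, h]

end overlay

/-- Register `r` of type natural number. -/
def NatExp.reg (N r : ℕ) : NatExp := .cell N (.const r)

/-- Register `r` of type real. -/
def RealExp.reg (N r : ℕ) : RealExp := .cell N (.const r) (.const 0) (.const 0)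

/-- Increment of a register. -/
def Cmd.incr (N r : ℕ) : Cmd := .setNat N (.const r) (.add (.reg N r) (.const 1))

/-- The body `c` is executed for the values `0, 1, …, bound - 1` of register `r`, which is finally
reset to zero. -/
def Cmd.forLoop (N r : ℕ) (bound : NatExp) (c : Cmd) : Cmd :=
  .seq (.loop (.natLt (.reg N r) bound) (.seq c (.incr N r))) (.setNat N (.const r) (.const 0))

theorem eval_reg {N : ℕ} {v : ℕ → ℕ} {w : ℕ → ℝ} {σ : State} (r : ℕ) :
    (NatExp.reg N r).eval (overlay N v w σ) = v r := overlay_nat_self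

theorem eval_real_reg {N : ℕ} {v : ℕ → ℕ} {w : ℕ → ℝ} {σ : State} (r : ℕ) :
    (RealExp.reg N r).eval (overlay N v w σ) = w r := overlay_real_self

theorem within_incr {S : ℕ → ℕ → ℝ} {N : ℕ} {v : ℕ → ℕ} {w : ℕ → ℝ} {σ : State} (r k : ℕ) :
    Within S (.incr N r) (overlay N (Function.update v r k) w σ)
      (overlay N (Function.update v r (k + 1)) w σ) 1 := by
  refine within_setNat ?_
  simp only [NatExp.eval, eval_reg, overlay_setNat_self, Function.update_self,
    Function.update_idem]

theorem within_forLoop {S : ℕ → ℕ → ℝ} {N r : ℕ} {bound : NatExp} {c : Cmd} {v : ℕ → ℕ}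
    {w : ℕ → ℝ} {st : ℕ → State} {M T : ℕ} (hv : v r = 0)
    (hb : ∀ k, bound.eval (overlay N (Function.update v r k) w (st k)) = M)
    (hc : ∀ k < M, Within S c (overlay N (Function.update v r k) w (st k))
      (overlay N (Function.update v r k) w (st (k + 1))) T) :
    Within S (.forLoop N r bound c) (overlay N v w (st 0)) (overlay N v w (st M))
      (M * (T + 2) + 2) := by
  have h1 : Within S (.loop (.natLt (.reg N r) bound) (.seq c (.incr N r))) _ _ _ :=
    within_loop (S := S) (p := .natLt (.reg N r) bound)
    (c := .seq c (.incr N r)) (st := fun k => overlay N (Function.update v r k) w (st k)) (M := M)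
    (T := T + 1)
    (fun k hk => by simpa only [Test.Holds, hb, eval_reg, Function.update_self] using hk)
    (fun k hk => (hc k hk).seq (within_incr r k))
    (by simp only [Test.Holds, hb, eval_reg, Function.update_self, lt_irrefl, not_false_eq_true])
  have h0 : Function.update v r 0 = v := by rw [← hv, Function.update_eq_self]
  have h2 : Within S (.setNat N (.const r) (.const 0))
      (overlay N (Function.update v r M) w (st M)) (overlay N v w (st M)) 1 := by
    refine within_setNat ?_
    simp only [NatExp.eval, overlay_setNat_self, Function.update_idem, h0]
  have h3 := h1.seq h2
  simp only [h0] at h3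
  exact h3

/-! ### The grid -/

/-- The `k`-th of `K` equidistant points in `[0, H)`. -/
def gridPoint (H : ℝ) (K k : ℕ) : ℝ := H * k / K

/-- The index of the largest grid point below `x`. -/
def cellIndex (H : ℝ) (K : ℕ) (x : ℝ) : ℕ :=
  open Classical in ((Finset.range K).filter fun k => gridPoint H K k ≤ x).card - 1

open Classical in
-- As the breakpoints increase, those not exceeding `x` form an initial segment, and their number
-- determines which ones they are.
theorem lt_card_filter_le_iff {t : ℕ → ℝ} {K : ℕ} (ht : ∀ k l, k < l → l < K → t k < t l) (x : ℝ)
    (j : ℕ) : j < ((Finset.range K).filter fun k => t k ≤ x).card ↔ j < K ∧ t j ≤ x := by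
  constructor
  · intro hj
    by_contra hcon
    refine absurd hj (not_lt.2 ?_)
    have : ((Finset.range K).filter fun k => t k ≤ x) ⊆ Finset.range j := by
      intro l hl
      rw [Finset.mem_filter, Finset.mem_range] at hl
      rw [Finset.mem_range]
      by_contra hjl
      refine hcon ⟨by omega, ?_⟩
      rcases (not_lt.1 hjl).eq_or_lt with h | h
      · rw [h]; exact hl.2
      · exact (ht j l h hl.1).le.trans hl.2
    simpa using Finset.card_le_card this
  · rintro ⟨hj, hjx⟩
    have : Finset.range (j + 1) ⊆ ((Finset.range K).filter fun k => t k ≤ x) := by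
      intro l hl
      rw [Finset.mem_range] at hl
      rw [Finset.mem_filter, Finset.mem_range]
      refine ⟨by omega, ?_⟩
      rcases (Nat.lt_succ_iff.1 hl).eq_or_lt with h | h
      · rw [h]; exact hjx
      · exact (ht l j h hj).le.trans hjx
    simpa using Finset.card_le_card this

theorem gridPoint_lt {H : ℝ} (hH : 0 < H) {K : ℕ} {k l : ℕ} (hkl : k < l) (hl : l < K) :
    gridPoint H K k < gridPoint H K l := by
  have : (0 : ℝ) < K := by exact_mod_cast (by omega : 0 < K)
  unfold gridPoint
  gcongr

/-- Together with `not_cellIndex` this says that a linear search from cell `0` stops exactly at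
`cellIndex`, for every real `x`. -/
theorem lt_cellIndex {H : ℝ} (hH : 0 < H) {K : ℕ} {x : ℝ} {c : ℕ} (hc : c < cellIndex H K x) :
    c + 1 < K ∧ gridPoint H K (c + 1) ≤ x :=
  (lt_card_filter_le_iff (fun _ _ => gridPoint_lt hH) x (c + 1)).1
    (by unfold cellIndex at hc; omega)

theorem not_cellIndex {H : ℝ} (hH : 0 < H) {K : ℕ} {x : ℝ} :
    ¬ (cellIndex H K x + 1 < K ∧ gridPoint H K (cellIndex H K x + 1) ≤ x) := by
  intro h
  have := (lt_card_filter_le_iff (fun _ _ => gridPoint_lt hH) x _).2 h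
  unfold cellIndex at this
  omega

open Classical in
theorem cellIndex_lt {H : ℝ} {K : ℕ} (hK : 0 < K) (x : ℝ) : cellIndex H K x < K := by
  unfold cellIndex
  have := Finset.card_filter_le (Finset.range K) fun k => gridPoint H K k ≤ x
  rw [Finset.card_range] at this
  omega

/-- The state `σ` with `K` written to the first `s` cells of the array of sizes and the grid points
written to the cells in `R` of the array of breakpoints. -/
def withGrid (H : ℝ) (K s : ℕ) (R : ℕ → ℕ → Prop) (σ : State) : State where
  nat a i := if a = 1 ∧ i < s then K else σ.nat a i
  real a i j k := open Classical in
    if a = 2 ∧ k = 0 ∧ R i j then gridPoint H K j else σ.real a i j k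
  drawn := σ.drawn

theorem withGrid_setNat {H : ℝ} {K s : ℕ} {R : ℕ → ℕ → Prop} {σ : State} :
    (withGrid H K s R σ).setNat 1 s K = withGrid H K (s + 1) R σ := by
  refine State.ext' (fun a i => ?_) (fun _ _ _ _ => rfl) fun _ => rfl
  simp only [State.setNat, withGrid]
  split_ifs <;> first | rfl | omega

theorem withGrid_setReal {H : ℝ} {K s i j : ℕ} {R : ℕ → ℕ → Prop} {σ : State} :
    (withGrid H K s R σ).setReal 2 i j 0 (gridPoint H K j) =
      withGrid H K s (fun a b => R a b ∨ (a = i ∧ b = j)) σ := by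
  refine State.ext' (fun _ _ => rfl) (fun a' i' j' k' => ?_) fun _ => rfl
  simp only [State.setReal, withGrid]
  split_ifs <;> grind

/-- The state `σ` with grids of `K` points for `n` bidders. -/
def fillGrid (H : ℝ) (K n : ℕ) (σ : State) : State := withGrid H K n (fun i j => i < n ∧ j < K) σ

/-- The grid point with index `e`, given `H` and the number of grid points in the registers. -/
def gridExp (N : ℕ) (e : NatExp) : RealExp :=
  .div (.mul (.reg N 0) (.ofNat e)) (.ofNat (.reg N 0))

theorem eval_gridExp {N : ℕ} {v : ℕ → ℕ} {w : ℕ → ℝ} {σ : State} (e : NatExp) :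
    (gridExp N e).eval (overlay N v w σ) = gridPoint (w 0) (v 0) (e.eval (overlay N v w σ)) := by
  simp only [gridExp, RealExp.eval, eval_real_reg, eval_reg, gridPoint]

/-- The program that writes the grids. -/
def gridProg (N : ℕ) : Cmd :=
  .forLoop N 3 (.reg N 6) (.seq (.setNat 1 (.reg N 3) (.reg N 0))
    (.forLoop N 4 (.reg N 0)
      (.setReal 2 (.reg N 3) (.reg N 4) (.const 0) (gridExp N (.reg N 4)))))

theorem within_gridProg {S : ℕ → ℕ → ℝ} {N : ℕ} (hN : 8 ≤ N) {v : ℕ → ℕ} {w : ℕ → ℝ}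
    (σ : State) (h3 : v 3 = 0) (h4 : v 4 = 0) :
    Within S (gridProg N) (overlay N v w σ) (overlay N v w (fillGrid (w 0) (v 0) (v 6) σ))
      (v 6 * ((1 + (v 0 * (1 + 2) + 2)) + 2) + 2) := by
  have hinit : fillGrid (w 0) (v 0) 0 σ = σ := by
    refine State.ext' (fun a i => ?_) (fun a i j k => ?_) fun _ => rfl <;> simp [fillGrid, withGrid]
  have := within_forLoop (S := S) (N := N) (r := 3) (bound := .reg N 6)
    (c := .seq (.setNat 1 (.reg N 3) (.reg N 0))
    (.forLoop N 4 (.reg N 0)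
      (.setReal 2 (.reg N 3) (.reg N 4) (.const 0) (gridExp N (.reg N 4))))) (v := v) (w := w)
    (st := fun i => fillGrid (w 0) (v 0) i σ) (M := v 6) (T := 1 + (v 0 * (1 + 2) + 2)) h3
    (fun k => by simp [eval_reg]) (fun i _ => ?_)
  · rw [hinit] at this; exact this
  have e0 : withGrid (w 0) (v 0) (i + 1) (fun a b => a < i ∧ b < v 0) σ =
      withGrid (w 0) (v 0) (i + 1) (fun a b => a < i ∧ b < v 0 ∨ a = i ∧ b < 0) σ := by
    simp
  have e1 : fillGrid (w 0) (v 0) (i + 1) σ =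
      withGrid (w 0) (v 0) (i + 1) (fun a b => a < i ∧ b < v 0 ∨ a = i ∧ b < v 0) σ := by
    unfold fillGrid; congr 1; funext a b; exact propext (by omega)
  refine Within.seq (σ₂ := overlay N (Function.update v 3 i) w
    (withGrid (w 0) (v 0) (i + 1) (fun a b => a < i ∧ b < v 0) σ)) (within_setNat ?_) ?_
  · have hv : Function.update v 3 i 0 = v 0 := by simp
    simp only [eval_reg, Function.update_self, hv]
    rw [overlay_setNat_ne (by omega), fillGrid, withGrid_setNat]
  · rw [e0, e1]
    refine within_forLoop (st := fun j => withGrid (w 0) (v 0) (i + 1)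
      (fun a b => a < i ∧ b < v 0 ∨ a = i ∧ b < j) σ) (by simp [h4]) (fun k => by simp [eval_reg])
      (fun j _ => within_setReal ?_)
    simp only [eval_reg, eval_gridExp, NatExp.eval]
    rw [overlay_setReal_ne (by omega)]
    congr 1
    have hv : Function.update (Function.update v 3 i) 4 j 0 = v 0 := by simp
    have hv3 : Function.update (Function.update v 3 i) 4 j 3 = i := by simp
    have hv4 : Function.update (Function.update v 3 i) 4 j 4 = j := by simp
    rw [hv, hv3, hv4, withGrid_setReal]
    congr 1; funext a b; exact propext (by omega)

/-! ### Empirical frequencies -/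

/-- The smoothed frequency of the cell `k` among the first `j` samples of bidder `i`. -/
def cellFreq (S : ℕ → ℕ → ℝ) (H : ℝ) (K m j i k : ℕ) : ℝ :=
  (1 + (((Finset.range j).filter fun r => cellIndex H K (S r i) = k).card : ℝ)) / (m + K)

theorem cellFreq_zero {S : ℕ → ℕ → ℝ} {H : ℝ} {K m i k : ℕ} :
    cellFreq S H K m 0 i k = 1 / (m + K) := by simp [cellFreq]

theorem cellFreq_succ {S : ℕ → ℕ → ℝ} {H : ℝ} {K m j i k : ℕ} :
    cellFreq S H K m (j + 1) i k =
      cellFreq S H K m j i k + if k = cellIndex H K (S j i) then 1 / ((m : ℝ) + K) else 0 := by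
  unfold cellFreq
  rw [Finset.range_add_one, Finset.filter_insert]
  by_cases h : k = cellIndex H K (S j i)
  · rw [if_pos h.symm, if_pos h, Finset.card_insert_of_notMem (by simp)]
    push_cast; ring
  · rw [if_neg (fun h' => h h'.symm), if_neg h, add_zero]

/-- The state `σ` after `cnt i` samples for bidder `i`, whose table of frequencies has `len i`
entries. -/
def withFreq (S : ℕ → ℕ → ℝ) (H : ℝ) (K m : ℕ) (len cnt : ℕ → ℕ) (σ : State) : State where
  nat := σ.nat
  real a i j k := if a = 3 ∧ k = 0 then (if j < len i then cellFreq S H K m (cnt i) i j else 0)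
    else σ.real a i j k
  drawn := cnt

theorem withFreq_setReal {S : ℕ → ℕ → ℝ} {H : ℝ} {K m i : ℕ} {len cnt : ℕ → ℕ} {σ : State}
    (hi : cnt i = 0) {j : ℕ} :
    (withFreq S H K m (Function.update len i j) cnt σ).setReal 3 i j 0 (1 / (m + K)) =
      withFreq S H K m (Function.update len i (j + 1)) cnt σ := by
  refine State.ext' (fun _ _ => rfl) (fun a' i' j' k' => ?_) fun _ => rfl
  have := cellFreq_zero (S := S) (H := H) (K := K) (m := m) (i := i) (k := j)
  simp only [State.setReal, withFreq, Function.update_apply]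
  split_ifs <;> grind

theorem withFreq_sample {S : ℕ → ℕ → ℝ} {H : ℝ} {K m i : ℕ} {len cnt : ℕ → ℕ} {σ : State}
    {j c : ℕ} (hc : c = cellIndex H K (S j i)) (hlen : c < len i) :
    ((withFreq S H K m len (Function.update cnt i j) σ).setReal 3 i c 0
      ((withFreq S H K m len (Function.update cnt i j) σ).real 3 i c 0 +
        1 / (m + K))).countDraw i =
      withFreq S H K m len (Function.update cnt i (j + 1)) σ := by
  refine State.ext' (fun _ _ => rfl) (fun a' i' j' k' => ?_) fun e => ?_
  · have := cellFreq_succ (S := S) (H := H) (K := K) (m := m) (i := i) (k := j') (j := j)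
    simp only [State.setReal, State.countDraw, withFreq, Function.update_apply]
    split_ifs <;> grind
  · simp only [State.setReal, State.countDraw, withFreq, Function.update_apply]
    split_ifs <;> simp_all

/-- `1 / (m + K)` for the registers `m` and `K`. -/
def unitExp (N : ℕ) : RealExp :=
  .div (.ofNat (.const 1)) (.add (.ofNat (.reg N 2)) (.ofNat (.reg N 0)))

theorem eval_unitExp {N : ℕ} {v : ℕ → ℕ} {w : ℕ → ℝ} {σ : State} :
    (unitExp N).eval (overlay N v w σ) = 1 / ((v 2 : ℝ) + v 0) := by
  simp [unitExp, RealExp.eval, eval_reg, NatExp.eval]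

/-- The program that draws a sample and updates the frequencies. -/
def sampleProg (N : ℕ) : Cmd :=
  .seq (.draw N (.const 2) (.const 0) (.const 0) (.reg N 3)) <|
  .seq (.loop (.and (.natLt (.add (.reg N 5) (.const 1)) (.reg N 0))
    (.not (.realLt (.reg N 2) (gridExp N (.add (.reg N 5) (.const 1)))))) (.incr N 5)) <|
  .seq (.setReal 3 (.reg N 3) (.reg N 5) (.const 0)
    (.add (.cell 3 (.reg N 3) (.reg N 5) (.const 0)) (unitExp N))) <|
  -- The search index and the sample register are cleared, so that every round starts with the same
  -- registers.
  .seq (.setNat N (.const 5) (.const 0)) <|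
  .setReal N (.const 2) (.const 0) (.const 0) (.ofNat (.const 0))

theorem within_sampleProg {S : ℕ → ℕ → ℝ} {N : ℕ} (hN : 8 ≤ N) {v : ℕ → ℕ} {w : ℕ → ℝ}
    (σ : State) (h5 : v 5 = 0) (hw : w 2 = 0) (hH : 0 < w 0) (hK : 0 < v 0) {c : ℕ}
    (hc : c = cellIndex (w 0) (v 0) (S (σ.drawn (v 3)) (v 3))) :
    Within S (sampleProg N) (overlay N v w σ) (overlay N v w ((σ.setReal 3 (v 3) c 0
      (σ.real 3 (v 3) c 0 + 1 / ((v 2 : ℝ) + v 0))).countDraw (v 3))) (v 0 * 2 + 5) := by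
  set x := S (σ.drawn (v 3)) (v 3) with hx
  set w' := Function.update w 2 x with hw'
  set τ := σ.countDraw (v 3) with hτ
  have hcK : c < v 0 := hc ▸ cellIndex_lt hK x
  have hv0 : Function.update v 5 0 = v := by rw [← h5, Function.update_eq_self]
  have s1 : Within S (.draw N (.const 2) (.const 0) (.const 0) (.reg N 3)) (overlay N v w σ)
      (overlay N v w' τ) 1 := by
    refine within_draw ?_
    simp only [NatExp.eval, eval_reg]
    rw [overlay_setReal_self]; rfl
  have s2 := within_loop (S := S) (p := (.and (.natLt (.add (.reg N 5) (.const 1)) (.reg N 0))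
    (.not (.realLt (.reg N 2) (gridExp N (.add (.reg N 5) (.const 1))))))) (c := .incr N 5)
    (T := 1) (M := c)
    (st := fun k => overlay N (Function.update v 5 k) w' τ) (fun k hk => ?_)
    (fun k _ => within_incr 5 k) ?_
  · have s3 : Within S (.setReal 3 (.reg N 3) (.reg N 5) (.const 0)
        (.add (.cell 3 (.reg N 3) (.reg N 5) (.const 0)) (unitExp N)))
        (overlay N (Function.update v 5 c) w' τ) (overlay N (Function.update v 5 c) w'
        (τ.setReal 3 (v 3) c 0 (σ.real 3 (v 3) c 0 + 1 / ((v 2 : ℝ) + v 0)))) 1 := by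
      refine within_setReal ?_
      have hv : Function.update v 5 c 0 = v 0 := by simp
      have hv2 : Function.update v 5 c 2 = v 2 := by simp
      have hv3 : Function.update v 5 c 3 = v 3 := by simp
      simp only [NatExp.eval, RealExp.eval, eval_reg, eval_unitExp, Function.update_self, hv, hv2,
        hv3]
      have hr : (overlay N (Function.update v 5 c) w' τ).real 3 (v 3) c 0 = σ.real 3 (v 3) c 0 :=
        overlay_real_ne (by omega)
      rw [overlay_setReal_ne (by omega), hr]
    have s4 : Within S (.setNat N (.const 5) (.const 0)) (overlay N (Function.update v 5 c) w'
        (τ.setReal 3 (v 3) c 0 (σ.real 3 (v 3) c 0 + 1 / ((v 2 : ℝ) + v 0)))) (overlay N v w'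
        (τ.setReal 3 (v 3) c 0 (σ.real 3 (v 3) c 0 + 1 / ((v 2 : ℝ) + v 0)))) 1 := by
      refine within_setNat ?_
      simp only [NatExp.eval]
      rw [overlay_setNat_self, Function.update_idem, hv0]
    have s5 : Within S (.setReal N (.const 2) (.const 0) (.const 0) (.ofNat (.const 0)))
        (overlay N v w'
        (τ.setReal 3 (v 3) c 0 (σ.real 3 (v 3) c 0 + 1 / ((v 2 : ℝ) + v 0)))) (overlay N v w
        (τ.setReal 3 (v 3) c 0 (σ.real 3 (v 3) c 0 + 1 / ((v 2 : ℝ) + v 0)))) 1 := by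
      refine within_setReal ?_
      simp only [NatExp.eval, RealExp.eval]
      rw [overlay_setReal_self, hw', Function.update_idem, Nat.cast_zero, ← hw,
        Function.update_eq_self]
    simp only [hv0] at s2
    refine (s1.seq (s2.seq (s3.seq (s4.seq s5)))).mono ?_
    omega
  · have := lt_cellIndex hH (hc ▸ hk)
    simp only [Test.Holds, NatExp.eval, eval_reg, eval_real_reg, eval_gridExp, not_lt]
    simpa [hw'] using this
  · have := not_cellIndex hH (K := v 0) (x := x)
    simp only [Test.Holds, NatExp.eval, eval_reg, eval_real_reg, eval_gridExp, not_lt]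
    rw [← hc] at this
    simpa [hw'] using this

/-- The program that computes the frequencies of the cells. -/
def freqProg (N : ℕ) : Cmd :=
  .forLoop N 3 (.reg N 6) (.seq
    (.forLoop N 4 (.reg N 0) (.setReal 3 (.reg N 3) (.reg N 4) (.const 0) (unitExp N)))
    (.forLoop N 4 (.reg N 2) (sampleProg N)))

/-- The state after the frequencies of the first `n` bidders have been computed. -/
def fillFreq (S : ℕ → ℕ → ℝ) (H : ℝ) (K m n : ℕ) (σ : State) : State :=
  withFreq S H K m (fun i => if i < n then K else 0) (fun i => if i < n then m else 0) σ

theorem within_freqProg {S : ℕ → ℕ → ℝ} {N : ℕ} (hN : 8 ≤ N) {v : ℕ → ℕ} {w : ℕ → ℝ}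
    (σ : State) (h3 : v 3 = 0) (h4 : v 4 = 0) (h5 : v 5 = 0) (hw : w 2 = 0) (hH : 0 < w 0)
    (hK : 0 < v 0) (hσ : ∀ i j, σ.real 3 i j 0 = 0) (hd : ∀ i, σ.drawn i = 0) :
    Within S (freqProg N) (overlay N v w σ)
      (overlay N v w (fillFreq S (w 0) (v 0) (v 2) (v 6) σ))
      (v 6 * (((v 0 * (1 + 2) + 2) + (v 2 * (v 0 * 2 + 5 + 2) + 2)) + 2) + 2) := by
  have hinit : fillFreq S (w 0) (v 0) (v 2) 0 σ = σ := by
    refine State.ext' (fun a i => rfl) (fun a i j k => ?_) fun e => ?_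
    · simp only [fillFreq, withFreq, not_lt_zero, if_false]
      split_ifs with h
      · rw [h.1, h.2, hσ]
      · rfl
    · simp [fillFreq, withFreq, hd]
  have := within_forLoop (S := S) (N := N) (r := 3) (bound := .reg N 6) (c := .seq
    (.forLoop N 4 (.reg N 0) (.setReal 3 (.reg N 3) (.reg N 4) (.const 0) (unitExp N)))
    (.forLoop N 4 (.reg N 2) (sampleProg N))) (v := v) (w := w)
    (st := fun i => fillFreq S (w 0) (v 0) (v 2) i σ) (M := v 6)
    (T := (v 0 * (1 + 2) + 2) + (v 2 * (v 0 * 2 + 5 + 2) + 2)) h3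
    (fun k => by simp [eval_reg]) (fun i _ => ?_)
  · rw [hinit] at this; exact this
  set len : ℕ → ℕ := fun r => if r < i then v 0 else 0 with hlen
  set cnt : ℕ → ℕ := fun r => if r < i then v 2 else 0 with hcnt
  have u1 : ∀ f : ℕ, Function.update (fun r => if r < i then f else 0) i f =
      fun r => if r < i + 1 then f else 0 := by
    intro f; funext r
    simp only [Function.update_apply]
    split_ifs <;> first | rfl | omega
  have u2 : ∀ f : ℕ, Function.update (fun r => if r < i then f else 0) i 0 =
      fun r => if r < i then f else 0 := by
    intro f; funext r
    simp only [Function.update_apply]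
    split_ifs <;> first | rfl | omega
  have e0 : fillFreq S (w 0) (v 0) (v 2) i σ =
      withFreq S (w 0) (v 0) (v 2) (Function.update len i 0) cnt σ := by
    rw [hlen, u2]; rfl
  have e1 : withFreq S (w 0) (v 0) (v 2) (Function.update len i (v 0)) cnt σ =
      withFreq S (w 0) (v 0) (v 2) (Function.update len i (v 0)) (Function.update cnt i 0) σ := by
    rw [hcnt, u2]
  have e2 : fillFreq S (w 0) (v 0) (v 2) (i + 1) σ =
      withFreq S (w 0) (v 0) (v 2) (Function.update len i (v 0))
        (Function.update cnt i (v 2)) σ := by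
    rw [hlen, hcnt, u1, u1]; rfl
  refine Within.seq (σ₂ := overlay N (Function.update v 3 i) w
    (withFreq S (w 0) (v 0) (v 2) (Function.update len i (v 0)) cnt σ)) ?_ ?_
  · rw [e0]
    refine within_forLoop
      (st := fun j => withFreq S (w 0) (v 0) (v 2) (Function.update len i j) cnt σ)
      (by simp [h4]) (fun k => by simp [eval_reg]) (fun j _ => within_setReal ?_)
    simp only [eval_reg, eval_unitExp, NatExp.eval]
    rw [overlay_setReal_ne (by omega)]
    congr 1
    have hv : Function.update (Function.update v 3 i) 4 j 0 = v 0 := by simp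
    have hv2 : Function.update (Function.update v 3 i) 4 j 2 = v 2 := by simp
    have hv3 : Function.update (Function.update v 3 i) 4 j 3 = i := by simp
    have hv4 : Function.update (Function.update v 3 i) 4 j 4 = j := by simp
    rw [hv, hv2, hv3, hv4, withFreq_setReal]
    simp [hcnt]
  · rw [e1, e2]
    refine within_forLoop
      (st := fun j => withFreq S (w 0) (v 0) (v 2) (Function.update len i (v 0))
        (Function.update cnt i j) σ)
      (by simp [h4]) (fun k => by simp [eval_reg]) (fun j _ => ?_)
    have hv : Function.update (Function.update v 3 i) 4 j 0 = v 0 := by simp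
    have hv2 : Function.update (Function.update v 3 i) 4 j 2 = v 2 := by simp
    have hv3 : Function.update (Function.update v 3 i) 4 j 3 = i := by simp
    have hv5 : Function.update (Function.update v 3 i) 4 j 5 = 0 := by simp [h5]
    have hs := within_sampleProg (S := S) hN (v := Function.update (Function.update v 3 i) 4 j)
      (w := w) (withFreq S (w 0) (v 0) (v 2) (Function.update len i (v 0))
        (Function.update cnt i j) σ) hv5 hw hH (by rw [hv]; exact hK) rfl
    rw [hv, hv2, hv3] at hs
    have hdr : (withFreq S (w 0) (v 0) (v 2) (Function.update len i (v 0))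
        (Function.update cnt i j) σ).drawn i = j := by simp [withFreq]
    rw [hdr, withFreq_sample rfl (by simpa using cellIndex_lt hK _)] at hs
    exact hs

/-! ### The sampling algorithm -/

/-- The number of grid points. -/
def gridSize (n : ℕ) (H ε : ℝ) : ℕ := ⌈20 * n * H / ε⌉₊

/-- The least `L` with `1 ≤ 2 ^ L * δ`. -/
def logSize (δ : ℝ) : ℕ := ⌈Real.logb 2 (1 / δ)⌉₊

/-- The number of samples. -/
def sampleSize (n K L : ℕ) : ℕ := K * K * (2 * n * (K + 1) + L)

/-- The machine has no rounding. In this form the ceiling is computed by counting up while the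
right-hand inequality holds; `lt_logSize` plays the same role for the logarithm. -/
theorem lt_gridSize {n : ℕ} {H ε : ℝ} (hε : 0 < ε) {k : ℕ} :
    k < gridSize n H ε ↔ k * ε < 20 * n * H := by
  rw [gridSize, Nat.lt_ceil, lt_div_iff₀ hε]

theorem lt_logSize {δ : ℝ} (hδ : 0 < δ) {k : ℕ} : k < logSize δ ↔ 2 ^ k * δ < 1 := by
  rw [logSize, Nat.lt_ceil, Real.lt_logb_iff_rpow_lt (by norm_num) (by positivity),
    Real.rpow_natCast, lt_div_iff₀ hδ]

/-- The contents of the registers of natural numbers. -/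
def regs (n K L m : ℕ) : ℕ → ℕ :=
  Function.update (Function.update (Function.update (Function.update 0 6 n) 0 K) 1 L) 2 m

/-- The contents of the real registers. -/
def realRegs (H p : ℝ) : ℕ → ℝ := Function.update (Function.update 0 0 H) 1 p

/-- The program that computes the sizes of the grid and of the sample. -/
def initProg (N : ℕ) : Cmd :=
  .seq (.setNat N (.const 6) (.reg 0 0)) <|
  .seq (.setReal N (.const 0) (.const 0) (.const 0) (.reg 0 0)) <|
  .seq (.loop (.realLt (.mul (.ofNat (.reg N 0)) (.reg 6 0))
    (.mul (.mul (.ofNat (.const 20)) (.ofNat (.reg N 6))) (.reg N 0))) (.incr N 0)) <|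
  .seq (.setReal N (.const 1) (.const 0) (.const 0) (.ofNat (.const 1))) <|
  .seq (.loop (.realLt (.mul (.reg N 1) (.reg 7 0)) (.ofNat (.const 1)))
    (.seq (.setReal N (.const 1) (.const 0) (.const 0) (.mul (.reg N 1) (.ofNat (.const 2))))
      (.incr N 1))) <|
  .seq (.loop (.realLt (.ofNat (.reg N 2))
    (.mul (.mul (.ofNat (.reg N 0)) (.ofNat (.reg N 0)))
      (.add (.mul (.mul (.ofNat (.const 2)) (.ofNat (.reg N 6)))
        (.add (.ofNat (.reg N 0)) (.ofNat (.const 1)))) (.ofNat (.reg N 1))))) (.incr N 2)) <|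
  -- `A` expects zeros in all cells outside its input format, so `ε` and `δ` are erased.
  .seq (.setReal 6 (.const 0) (.const 0) (.const 0) (.ofNat (.const 0)))
    (.setReal 7 (.const 0) (.const 0) (.const 0) (.ofNat (.const 0)))

theorem eval_reg_ne {N a r : ℕ} (h : a ≠ N) {v : ℕ → ℕ} {w : ℕ → ℝ} {σ : State} :
    (NatExp.reg a r).eval (overlay N v w σ) = σ.nat a r := overlay_nat_ne h

theorem eval_real_reg_ne {N a r : ℕ} (h : a ≠ N) {v : ℕ → ℕ} {w : ℕ → ℝ} {σ : State} :
    (RealExp.reg a r).eval (overlay N v w σ) = σ.real a r 0 0 := overlay_real_ne h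

theorem update_zero_of_eq_zero {v : ℕ → ℕ} {r : ℕ} (h : v r = 0) : Function.update v r 0 = v := by
  rw [← h, Function.update_eq_self]

theorem within_initProg {S : ℕ → ℕ → ℝ} {N : ℕ} (hN : 8 ≤ N) (n : ℕ) (H ε' : ℝ) {ε δ : ℝ}
    (hε : 0 < ε) (hδ : 0 < δ) {K L : ℕ} (hK : K = gridSize n H ε) (hL : L = logSize δ) :
    Within S (initProg N) (samplingInput n H ε' ε δ)
      (overlay N (regs n K L (sampleSize n K L)) (realRegs H (2 ^ L)) (samplingInput n H ε' 0 0))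
      (2 * K + 3 * L + 2 * sampleSize n K L + 8) := by
  set σ := samplingInput n H ε' ε δ with hσ
  have h6 : 6 ≠ N := by omega
  have h7 : 7 ≠ N := by omega
  have h0 : 0 ≠ N := by omega
  have s0 : σ = overlay N 0 0 σ := by
    refine (overlay_eq_self ?_ ?_).symm
    · funext i
      simp only [hσ, samplingInput, Pi.zero_apply]
      rw [if_neg (by omega)]
    · intro i j k
      simp only [hσ, samplingInput, Pi.zero_apply, ite_self]
      rw [if_neg (show N ≠ 0 by omega), if_neg (show N ≠ 1 by omega), if_neg (show N ≠ 6 by omega),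
        if_neg (show N ≠ 7 by omega), ite_self]
  set v₁ : ℕ → ℕ := Function.update 0 6 n with hv₁
  set w₁ : ℕ → ℝ := Function.update 0 0 H with hw₁
  set v₂ : ℕ → ℕ := Function.update v₁ 0 K with hv₂
  set v₃ : ℕ → ℕ := Function.update v₂ 1 L with hv₃
  have s1 : Within S (.setNat N (.const 6) (.reg 0 0)) σ (overlay N v₁ 0 σ) 1 := by
    nth_rw 1 [s0]
    refine within_setNat ?_
    rw [eval_reg_ne h0]
    exact overlay_setNat_self
  have s2 : Within S (.setReal N (.const 0) (.const 0) (.const 0) (.reg 0 0)) (overlay N v₁ 0 σ)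
      (overlay N v₁ w₁ σ) 1 := by
    refine within_setReal ?_
    rw [eval_real_reg_ne h0]
    exact overlay_setReal_self
  have hv₁0 : Function.update v₁ 0 0 = v₁ := update_zero_of_eq_zero (by simp [hv₁])
  have s3 := within_loop (S := S) (p := .realLt (.mul (.ofNat (.reg N 0)) (.reg 6 0))
      (.mul (.mul (.ofNat (.const 20)) (.ofNat (.reg N 6))) (.reg N 0))) (c := .incr N 0)
      (M := K) (T := 1) (st := fun k => overlay N (Function.update v₁ 0 k) w₁ σ)
      (fun k hk => by
        rw [hK, lt_gridSize hε] at hk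
        simp only [Test.Holds, RealExp.eval, NatExp.eval, eval_reg, eval_real_reg,
          eval_real_reg_ne h6]
        simpa [hv₁, hw₁, hσ, samplingInput] using hk)
      (fun k _ => within_incr 0 k)
      (by
        have hk := (lt_gridSize (n := n) (H := H) hε (k := K)).not.1 (by rw [hK]; exact lt_irrefl _)
        simp only [Test.Holds, RealExp.eval, NatExp.eval, eval_reg, eval_real_reg,
          eval_real_reg_ne h6]
        simpa [hv₁, hw₁, hσ, samplingInput] using hk)
  simp only [hv₁0] at s3
  have s4 : Within S (.setReal N (.const 1) (.const 0) (.const 0) (.ofNat (.const 1)))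
      (overlay N v₂ w₁ σ) (overlay N v₂ (Function.update w₁ 1 (2 ^ 0)) σ) 1 := by
    refine within_setReal ?_
    simp only [NatExp.eval, RealExp.eval]
    rw [overlay_setReal_self]; simp
  have hv₂0 : Function.update v₂ 1 0 = v₂ := update_zero_of_eq_zero (by simp [hv₂, hv₁])
  have s5 := within_loop (S := S) (p := .realLt (.mul (.reg N 1) (.reg 7 0)) (.ofNat (.const 1)))
      (c := .seq (.setReal N (.const 1) (.const 0) (.const 0) (.mul (.reg N 1) (.ofNat (.const 2))))
        (.incr N 1))
      (M := L) (T := 1 + 1)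
      (st := fun k => overlay N (Function.update v₂ 1 k) (Function.update w₁ 1 (2 ^ k)) σ)
      (fun k hk => by
        rw [hL, lt_logSize hδ] at hk
        simp only [Test.Holds, RealExp.eval, NatExp.eval, eval_real_reg,
          eval_real_reg_ne h7]
        simpa [hσ, samplingInput] using hk)
      (fun k _ => by
        refine Within.seq (σ₂ := overlay N (Function.update v₂ 1 k)
          (Function.update w₁ 1 (2 ^ (k + 1))) σ) (within_setReal ?_) (within_incr 1 k)
        simp only [NatExp.eval, RealExp.eval, eval_real_reg]
        rw [overlay_setReal_self, Function.update_idem]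
        simp [pow_succ])
      (by
        have hk := (lt_logSize hδ (k := L)).not.1 (by rw [hL]; exact lt_irrefl _)
        simp only [Test.Holds, RealExp.eval, NatExp.eval, eval_real_reg,
          eval_real_reg_ne h7]
        simpa [hσ, samplingInput] using hk)
  simp only [hv₂0] at s5
  have hv₃0 : Function.update v₃ 2 0 = v₃ := update_zero_of_eq_zero (by simp [hv₃, hv₂, hv₁])
  have heval : ∀ k, (RealExp.mul (.mul (.ofNat (.reg N 0)) (.ofNat (.reg N 0)))
      (.add (.mul (.mul (.ofNat (.const 2)) (.ofNat (.reg N 6)))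
        (.add (.ofNat (.reg N 0)) (.ofNat (.const 1)))) (.ofNat (.reg N 1)))).eval
      (overlay N (Function.update v₃ 2 k) (Function.update w₁ 1 (2 ^ L)) σ) =
      (sampleSize n K L : ℝ) := by
    intro k
    simp [RealExp.eval, NatExp.eval, eval_reg, sampleSize, hv₃, hv₂, hv₁]
  have s6 := within_loop (S := S) (p := .realLt (.ofNat (.reg N 2))
    (.mul (.mul (.ofNat (.reg N 0)) (.ofNat (.reg N 0)))
      (.add (.mul (.mul (.ofNat (.const 2)) (.ofNat (.reg N 6)))
        (.add (.ofNat (.reg N 0)) (.ofNat (.const 1)))) (.ofNat (.reg N 1)))))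
      (c := .incr N 2) (M := sampleSize n K L) (T := 1)
      (st := fun k => overlay N (Function.update v₃ 2 k) (Function.update w₁ 1 (2 ^ L)) σ)
      (fun k hk => by
        rw [Test.Holds, heval]
        simpa [RealExp.eval, eval_reg] using hk)
      (fun k _ => within_incr 2 k)
      (by
        rw [Test.Holds, heval]
        simp [RealExp.eval, eval_reg])
  simp only [hv₃0] at s6
  have s7 : Within S (.setReal 6 (.const 0) (.const 0) (.const 0) (.ofNat (.const 0)))
      (overlay N (regs n K L (sampleSize n K L)) (realRegs H (2 ^ L)) σ)
      (overlay N (regs n K L (sampleSize n K L)) (realRegs H (2 ^ L))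
        (samplingInput n H ε' 0 δ)) 1 := by
    refine within_setReal ?_
    simp only [NatExp.eval, RealExp.eval]
    rw [overlay_setReal_ne h6]
    congr 1
    refine State.ext' (fun _ _ => rfl) (fun a i j k => ?_) fun _ => rfl
    simp only [State.setReal, hσ, samplingInput]
    split_ifs <;> grind
  have s8 : Within S (.setReal 7 (.const 0) (.const 0) (.const 0) (.ofNat (.const 0)))
      (overlay N (regs n K L (sampleSize n K L)) (realRegs H (2 ^ L))
        (samplingInput n H ε' 0 δ))
      (overlay N (regs n K L (sampleSize n K L)) (realRegs H (2 ^ L))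
        (samplingInput n H ε' 0 0)) 1 := by
    refine within_setReal ?_
    simp only [NatExp.eval, RealExp.eval]
    rw [overlay_setReal_ne h7]
    congr 1
    refine State.ext' (fun _ _ => rfl) (fun a i j k => ?_) fun _ => rfl
    simp only [State.setReal, samplingInput]
    split_ifs <;> grind
  refine (s1.seq (s2.seq (s3.seq (s4.seq (s5.seq (s6.seq (s7.seq s8))))))).mono ?_
  omega

/-! ### The smoothed distribution and the complete algorithm. -/

/-- The smoothed distribution of the samples on the grid. -/
def smoothed (n : ℕ) {H : ℝ} (hH : 0 < H) (S : ℕ → ℕ → ℝ) {K : ℕ} (hK : 0 < K) (m : ℕ) :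
    DiscreteProduct n H where
  size _ := K
  val _ k := gridPoint H K k
  prob i k := cellFreq S H K m m i k
  val_mem i k hk := by
    have : (0 : ℝ) < K := by exact_mod_cast hK
    have : (k : ℝ) ≤ K := by exact_mod_cast hk.le
    refine ⟨by unfold gridPoint; positivity, ?_⟩
    unfold gridPoint
    rw [div_le_iff₀ (by assumption)]
    gcongr
  val_lt i k l := gridPoint_lt hH
  prob_pos i k _ := by
    have : (0 : ℝ) < K := by exact_mod_cast hK
    unfold cellFreq; positivity
  prob_sum i := by
    have hK' : (0 : ℝ) < K := by exact_mod_cast hK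
    unfold cellFreq
    rw [← Finset.sum_div, Finset.sum_add_distrib, ← Nat.cast_sum,
      ← Finset.card_eq_sum_card_fiberwise fun r _ => by
        simpa using cellIndex_lt hK (S r i)]
    simp only [Finset.sum_const, Finset.card_range, nsmul_eq_mul, mul_one]
    rw [add_comm]
    exact div_self (by positivity)

/-- The memory prepared by the first three programs is a correct input for `A` on all arrays that
`A` may touch. The sample counters differ, but a program without draws never reads them. -/
theorem agreeBelow_discreteInput {n : ℕ} {H : ℝ} (hH : 0 < H) (ε' : ℝ) (S : ℕ → ℕ → ℝ) {K : ℕ}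
    (hK : 0 < K) (m N : ℕ) (v : ℕ → ℕ) (w : ℕ → ℝ) :
    AgreeBelow N (discreteInput ε' (smoothed n hH S hK m))
      (overlay N v w (fillFreq S H K m n (fillGrid H K n (samplingInput n H ε' 0 0)))) := by
  constructor
  · intro a ha
    funext i
    have : a ≠ N := by omega
    simp only [discreteInput, overlay, fillFreq, withFreq, fillGrid, withGrid, samplingInput,
      smoothed, extend, this, if_false]
    split_ifs <;> grind
  · intro a ha
    funext i j k
    rw [overlay_real_ne (by omega)]
    by_cases h2 : a = 2
    · subst h2
      by_cases hi : i < n <;> by_cases hj : j < K <;> by_cases hk : k = 0 <;>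
        simp [discreteInput, fillFreq, withFreq, fillGrid, withGrid, samplingInput,
          smoothed, extend, hi, hj, hk]
    by_cases h3 : a = 3
    · subst h3
      by_cases hi : i < n <;> by_cases hj : j < K <;> by_cases hk : k = 0 <;>
        simp [discreteInput, fillFreq, withFreq, fillGrid, withGrid, samplingInput,
          smoothed, extend, hi, hj, hk]
    by_cases hc : i = 0 ∧ j = 0 ∧ k = 0
    · simp [discreteInput, fillFreq, withFreq, fillGrid, withGrid, samplingInput, h2, h3, hc]
    · simp [discreteInput, fillFreq, withFreq, fillGrid, withGrid, samplingInput, h2, h3, hc]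

theorem stepFun_congr {K : ℕ} {t t' : ℕ → ℝ} (h : ∀ k < K, t k = t' k) (b : ℕ → ℝ) :
    stepFun K t b = stepFun K t' b := by
  classical
  funext x
  have : ((Finset.range K).filter fun k => t k ≤ x) = (Finset.range K).filter fun k => t' k ≤ x :=
    Finset.filter_congr fun k hk => by rw [h k (Finset.mem_range.1 hk)]
  unfold stepFun
  simp only [this]

theorem profile_congr {n : ℕ} {σ τ : State} (h2 : σ.nat 2 = τ.nat 2) (h4 : σ.real 4 = τ.real 4)
    (h5 : σ.real 5 = τ.real 5) {K K' : Fin n → ℕ} (hK : K = K') {t t' : Fin n → ℕ → ℝ}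
    (ht : ∀ i, ∀ k < K i, t i k = t' i k) : σ.profile K t = τ.profile K' t' := by
  subst hK
  unfold State.profile
  rw [h2, h4, h5]
  congr 1
  funext i l
  exact stepFun_congr (ht i) _

/-- The sampling algorithm: compute an equilibrium for the smoothed empirical distribution on a
grid and extend it by step functions. The arrays from `N` on are used as registers. -/
def samplingAlgorithm (A : Cmd) (N : ℕ) : Cmd :=
  .seq (initProg N) <| .seq (gridProg N) <| .seq (freqProg N) <| .seq A (gridProg N)

/-- The profile is read off the same arrays in both formats; only the sizes and breakpoints must be
made explicit. The bound adds the costs of the initialization, two passes over the grid, the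
frequency count and `A`. -/
theorem exec_samplingAlgorithm {A : Cmd} (hA : A.DrawFree) {N : ℕ} (hN : 8 ≤ N)
    (hAN : A.arrays ≤ N) {n : ℕ} {H : ℝ} (hH : 0 < H) (ε' : ℝ) {ε δ : ℝ} (hε : 0 < ε) (hδ : 0 < δ)
    (S : ℕ → ℕ → ℝ) {K L m : ℕ} (hK : K = gridSize n H ε) (hL : L = logSize δ)
    (hm : m = sampleSize n K L) (hK0 : 0 < K) {σ : State} {t : ℕ}
    (h : Exec 0 A (discreteInput ε' (smoothed n hH S hK0 m)) σ t) :
    ∃ τ T, Exec S (samplingAlgorithm A N) (samplingInput n H ε' ε δ) τ T ∧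
      samplingOutput n τ = discreteOutput (smoothed n hH S hK0 m) σ ∧
      T ≤ (2 * K + 3 * L + 2 * m + 8) + (2 * (n * (3 * K + 5) + 2) +
        (n * (3 * K + m * (2 * K + 7) + 6) + 2)) + t := by
  set v := regs n K L m with hv
  set w := realRegs H (2 ^ L) with hw
  have r0 : v 0 = K := by simp [hv, regs]
  have r2 : v 2 = m := by simp [hv, regs]
  have r6 : v 6 = n := by simp [hv, regs]
  have q0 : w 0 = H := by simp [hw, realRegs]
  have r3 : v 3 = 0 := by simp [hv, regs]
  have r4 : v 4 = 0 := by simp [hv, regs]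
  have r5 : v 5 = 0 := by simp [hv, regs]
  have q2 : w 2 = 0 := by simp [hw, realRegs]
  have s1 := within_initProg (S := S) hN n H ε' hε hδ hK hL
  rw [← hm, ← hv, ← hw] at s1
  have s2 := within_gridProg (S := S) hN (w := w) (samplingInput n H ε' 0 0) r3 r4
  have s3 := within_freqProg (S := S) hN (w := w) (fillGrid H K n (samplingInput n H ε' 0 0))
    r3 r4 r5 q2 (by rw [q0]; exact hH) (by rw [r0]; exact hK0)
    (fun i j => by simp [fillGrid, withGrid, samplingInput])
    (fun i => rfl)
  rw [r0, r6, q0] at s2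
  rw [r0, r6, r2, q0] at s3
  obtain ⟨τ, e4, hlow, hhigh⟩ := h.simulate (S' := S) hA hAN
    (agreeBelow_discreteInput hH ε' S hK0 m N v w)
  -- `A` does not write to array `N`, so the registers survive its run.
  have hτ : overlay N v w τ = τ := by
    refine overlay_eq_self ?_ fun i j k => ?_
    · rw [← hhigh.1 N le_rfl]; funext i; exact overlay_nat_self
    · rw [← hhigh.2 N le_rfl]; simp [overlay]
  have s4 : Within S A _ τ t := ⟨t, le_rfl, e4⟩
  -- `A` may have overwritten its input, so the sizes and breakpoints are written a second time.
  have s5 := within_gridProg (S := S) hN (w := w) τ r3 r4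
  rw [r0, r6, q0, hτ] at s5
  obtain ⟨T, hT, hexec⟩ := s1.seq (s2.seq (s3.seq (s4.seq s5)))
  refine ⟨_, T, hexec, ?_, ?_⟩
  · have lt : ∀ {a}, a < 8 → a ≠ N := fun ha => by omega
    refine profile_congr ?_ ?_ ?_ ?_ ?_
    · funext i
      rw [overlay_nat_ne (lt (by norm_num)), hlow.1 2 (by omega)]
      simp [fillGrid, withGrid]
    · funext i j k
      rw [overlay_real_ne (lt (by norm_num)), hlow.2 4 (by omega)]
      simp [fillGrid, withGrid]
    · funext i j k
      rw [overlay_real_ne (lt (by norm_num)), hlow.2 5 (by omega)]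
      simp [fillGrid, withGrid]
    · funext i
      rw [overlay_nat_ne (lt (by norm_num))]
      simp [fillGrid, withGrid, smoothed]
    · intro i k hk
      rw [overlay_nat_ne (lt (by norm_num))] at hk
      rw [overlay_real_ne (lt (by norm_num))]
      have hk' : k < K := by simpa [fillGrid, withGrid] using hk
      simp [fillGrid, withGrid, smoothed, hk']
  · refine hT.trans (le_of_eq ?_)
    ring

/-! ### Correctness of the sampling algorithm -/

open Classical in
theorem zero_lt_card_filter_gridPoint {H : ℝ} (hH : 0 < H) {K : ℕ} (hK : 0 < K) {x : ℝ}
    (hx : 0 ≤ x) : 0 < ((Finset.range K).filter fun k => gridPoint H K k ≤ x).card :=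
  (lt_card_filter_le_iff (fun _ _ => gridPoint_lt hH) x 0).2 ⟨hK, by simpa [gridPoint] using hx⟩

theorem stepFun_gridPoint {H : ℝ} (hH : 0 < H) {K : ℕ} (hK : 0 < K) (b : ℕ → ℝ) {x : ℝ}
    (hx : 0 ≤ x) : stepFun K (gridPoint H K) b x = b (cellIndex H K x) := by
  have := zero_lt_card_filter_gridPoint hH hK hx
  unfold stepFun cellIndex
  simp only
  rw [if_neg this.ne']

theorem gridPoint_cellIndex_le {H : ℝ} (hH : 0 < H) {K : ℕ} (hK : 0 < K) {x : ℝ} (hx : 0 ≤ x) :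
    gridPoint H K (cellIndex H K x) ≤ x := by
  classical
  have := zero_lt_card_filter_gridPoint hH hK hx
  refine ((lt_card_filter_le_iff (fun _ _ => gridPoint_lt hH) x _).1 ?_).2
  unfold cellIndex
  omega

theorem sub_gridPoint_cellIndex_le {H : ℝ} (hH : 0 < H) {K : ℕ} (hK : 0 < K) {x : ℝ}
    (hx : x ≤ H) : x - gridPoint H K (cellIndex H K x) ≤ H / K := by
  have hK' : (0 : ℝ) < K := by exact_mod_cast hK
  have e : gridPoint H K (cellIndex H K x + 1) = gridPoint H K (cellIndex H K x) + H / K := by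
    unfold gridPoint; push_cast; ring
  rcases (Nat.succ_le_of_lt (cellIndex_lt (H := H) hK x)).lt_or_eq with h | h
  · have : ¬ gridPoint H K (cellIndex H K x + 1) ≤ x := fun h' => not_cellIndex hH ⟨h, h'⟩
    linarith [not_le.1 this]
  -- The last cell has no right neighbour in the grid; `H` takes its place.
  · have : gridPoint H K (cellIndex H K x + 1) = H := by
      rw [show cellIndex H K x + 1 = K from h, gridPoint]; field_simp
    linarith

theorem cellIndex_mono {H : ℝ} {K : ℕ} {x y : ℝ} (hxy : x ≤ y) :
    cellIndex H K x ≤ cellIndex H K y := by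
  classical
  unfold cellIndex
  refine Nat.sub_le_sub_right (Finset.card_le_card fun k hk => ?_) 1
  rw [Finset.mem_filter] at hk ⊢
  exact ⟨hk.1, hk.2.trans hxy⟩

theorem gridPoint_mono {H : ℝ} (hH : 0 < H) {K k l : ℕ} (hkl : k ≤ l) :
    gridPoint H K k ≤ gridPoint H K l := by
  unfold gridPoint; gcongr

theorem cellIndex_gridPoint {H : ℝ} (hH : 0 < H) {K k : ℕ} (hk : k < K) :
    cellIndex H K (gridPoint H K k) = k := by
  classical
  have h : ∀ j, j < ((Finset.range K).filter fun l => gridPoint H K l ≤ gridPoint H K k).card ↔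
      j < k + 1 := fun j => by
    rw [lt_card_filter_le_iff (fun _ _ => gridPoint_lt hH)]
    constructor
    · rintro ⟨h1, h2⟩
      by_contra h3
      exact absurd (gridPoint_lt hH (by omega : k < j) h1) (not_lt.2 h2)
    · intro h; exact ⟨by omega, gridPoint_mono hH (by omega)⟩
  unfold cellIndex
  have h1 := h k
  have h2 := h (k + 1)
  omega

theorem DiscreteProduct.marginal_real {n : ℕ} {H : ℝ} (D : DiscreteProduct n H) (i : Fin n)
    (A : Set ℝ) : (D.marginal i).real A =
      ∑ k ∈ Finset.range (D.size i), D.prob i k * A.indicator (fun _ => (1 : ℝ)) (D.val i k) := by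
  classical
  unfold marginal
  simp only [measureReal_def, Measure.smul_apply, Measure.finsetSum_apply, smul_eq_mul]
  rw [ENNReal.toReal_sum]
  · refine Finset.sum_congr rfl fun k hk => ?_
    rw [ENNReal.toReal_mul, ENNReal.toReal_ofReal (D.prob_pos i k (Finset.mem_range.1 hk)).le]
    by_cases h : D.val i k ∈ A <;> simp [h]
  · intro k _
    exact ENNReal.mul_ne_top ENNReal.ofReal_ne_top (measure_ne_top _ _)

theorem DiscreteProduct.isProbabilityMeasure_marginal {n : ℕ} {H : ℝ} (D : DiscreteProduct n H)
    (i : Fin n) : IsProbabilityMeasure (D.marginal i) := by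
  constructor
  unfold marginal
  simp only [Measure.smul_apply, Measure.finsetSum_apply, measure_univ, smul_eq_mul, mul_one]
  rw [← ENNReal.ofReal_sum_of_nonneg fun k hk => (D.prob_pos i k (Finset.mem_range.1 hk)).le,
    D.prob_sum, ENNReal.ofReal_one]

theorem DiscreteProduct.ae_marginal {n : ℕ} {H : ℝ} (D : DiscreteProduct n H) (i : Fin n)
    {T : Set ℝ} (hT : ∀ k < D.size i, D.val i k ∈ T) : ∀ᵐ x ∂(D.marginal i), x ∈ T := by
  rw [ae_iff]
  unfold marginal
  rw [Measure.finsetSum_apply]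
  refine Finset.sum_eq_zero fun k hk => ?_
  simp [hT k (Finset.mem_range.1 hk)]

/-- The cost of smoothing, with `a` the number of samples and `b` the number of grid points in an
event: the difference is `(a / m * K - b) / (m + K)`, whose numerator is at most `K` in absolute
value, and `m ≥ K ^ 2`. -/
theorem abs_div_sub_add_div_le {a b m K : ℝ} (hm : 0 < m) (hK : 0 < K) (ha : 0 ≤ a) (ham : a ≤ m)
    (hb : 0 ≤ b) (hbK : b ≤ K) (hmK : K ^ 2 ≤ m) : |a / m - (b + a) / (m + K)| ≤ 1 / K := by
  have e : a / m - (b + a) / (m + K) = (a / m * K - b) / (m + K) := by field_simp; ring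
  have h1 : a / m ≤ 1 := by rw [div_le_one hm]; exact ham
  have h0 : 0 ≤ a / m := by positivity
  rw [e, abs_div, abs_of_pos (show 0 < m + K by positivity),
    div_le_div_iff₀ (by positivity) hK]
  have : |a / m * K - b| ≤ K := abs_le.2 ⟨by nlinarith, by nlinarith⟩
  nlinarith

/-- Strategies that are constant on the cells of the grid have nearly the same bid distribution
under the empirical distribution and under the smoothed one. -/
theorem abs_empirical_sub_smoothed_le {n : ℕ} {H : ℝ} (hH : 0 < H) {K m : ℕ} (hK : 0 < K)
    (hm : K * K ≤ m) {ω : ℕ → Fin n → ℝ} (i : Fin n) {s : ℝ → ℝ}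
    (hs : ∀ j, s (gridPoint H K (cellIndex H K (ω j i))) = s (ω j i)) (B : Set ℝ) :
    |(empirical m ω i).real {x | s x ∈ B} -
      ((smoothed n hH (fun j => extend (ω j)) hK m).marginal i).real {x | s x ∈ B}| ≤ 1 / K := by
  classical
  have hK' : (0 : ℝ) < K := by exact_mod_cast hK
  have hmK : (K : ℝ) ^ 2 ≤ m := by rw [pow_two]; exact_mod_cast hm
  have hm' : (0 : ℝ) < m := lt_of_lt_of_le (by positivity) hmK
  set g : ℕ → ℝ := fun k => {x | s x ∈ B}.indicator (fun _ => (1 : ℝ)) (gridPoint H K k) with hg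
  have hg0 : ∀ k, 0 ≤ g k := fun k => Set.indicator_nonneg (fun _ _ => zero_le_one) _
  have hg1 : ∀ k, g k ≤ 1 := fun k =>
    Set.indicator_apply_le' (fun _ => le_rfl) (fun _ => zero_le_one)
  have h1 : ∀ j, {x | s x ∈ B}.indicator (fun _ => (1 : ℝ)) (ω j i) =
      g (cellIndex H K (ω j i)) := by
    intro j
    simp only [hg, Set.indicator_apply, Set.mem_ofPred_eq, hs j]
  have hext : ∀ r, extend (ω r) (i : ℕ) = ω r i := fun r => by simp [extend]
  have h2 : ∑ k ∈ Finset.range K, (smoothed n hH (fun j => extend (ω j)) hK m).prob i k * g k =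
      (∑ k ∈ Finset.range K, g k + ∑ j ∈ Finset.range m, g (cellIndex H K (ω j i))) / (m + K) := by
    rw [← Finset.sum_fiberwise_of_maps_to (s := Finset.range m) (t := Finset.range K)
      (g := fun j => cellIndex H K (ω j i)) (fun r _ => by simpa using cellIndex_lt hK _),
      ← Finset.sum_add_distrib, Finset.sum_div]
    refine Finset.sum_congr rfl fun k _ => ?_
    have : ∑ j ∈ (Finset.range m).filter (fun j => cellIndex H K (ω j i) = k),
        g (cellIndex H K (ω j i)) =
        (((Finset.range m).filter fun j => cellIndex H K (ω j i) = k).card : ℝ) * g k := by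
      rw [Finset.sum_congr rfl fun j hj => by rw [(Finset.mem_filter.1 hj).2], Finset.sum_const,
        nsmul_eq_mul]
    rw [this]
    simp only [smoothed, cellFreq, hext]
    ring
  rw [empirical_apply, DiscreteProduct.marginal_real]
  simp only [h1]
  change |_ - ∑ k ∈ Finset.range K, _ * g k| ≤ _
  rw [h2, inv_mul_eq_div]
  have c : ∀ (N : ℕ) (f : ℕ → ℕ), ∑ j ∈ Finset.range N, g (f j) ≤ N := fun N f => by
    simpa using Finset.sum_le_card_nsmul (Finset.range N) (fun j => g (f j)) 1 fun j _ => hg1 _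
  exact abs_div_sub_add_div_le hm' hK' (Finset.sum_nonneg fun _ _ => hg0 _) (c m _)
    (Finset.sum_nonneg fun _ _ => hg0 _) (c K id) hmK

/-- An equilibrium for the smoothed distribution of representative samples, extended by step
functions, is an equilibrium for the true distribution. -/
theorem isMonotoneBNE_of_smoothed {n : ℕ} (hn : 0 < n) {H : ℝ} (hH : 0 < H) {K m : ℕ} (hK : 0 < K)
    (hm : K * K ≤ m) {ω : ℕ → Fin n → ℝ} {F : Fin n → Measure ℝ}
    [∀ i, IsProbabilityMeasure (F i)] {T : Fin n → Set ℝ} (hTH : ∀ i, T i ⊆ Set.Icc 0 H)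
    (hT : ∀ i, ∀ᵐ v ∂(F i), v ∈ T i) (hω : ∀ j i, ω j i ∈ T i)
    (hclose : UniformlyClose F m (2 / K) ω) {κ : Kind} {ε' ε : ℝ} (hε : 20 * n * H ≤ K * ε)
    {σ : State}
    (h : IsMonotoneBNE κ H ε' (smoothed n hH (fun j => extend (ω j)) hK m).marginal
      (smoothed n hH (fun j => extend (ω j)) hK m).support
      (discreteOutput (smoothed n hH (fun j => extend (ω j)) hK m) σ)) :
    IsMonotoneBNE κ H (ε' + ε) F T
      (discreteOutput (smoothed n hH (fun j => extend (ω j)) hK m) σ) := by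
  have hK' : (0 : ℝ) < K := by exact_mod_cast hK
  have hn' : (1 : ℝ) ≤ n := by exact_mod_cast hn
  set D := smoothed n hH (fun j => extend (ω j)) hK m with hD
  set P := discreteOutput D σ with hP
  obtain ⟨hκ, hval, hmon, hbne⟩ := h
  set ρ : ℝ → ℝ := fun x => gridPoint H K (cellIndex H K x) with hρ
  have hρD : ∀ i x, ρ x ∈ D.support i := fun i x => ⟨_, cellIndex_lt hK x, rfl⟩
  have hρ0 : ∀ x, 0 ≤ ρ x := fun x => by simp only [hρ, gridPoint]; positivity
  have hcρ : ∀ x, cellIndex H K (ρ x) = cellIndex H K x := fun x =>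
    cellIndex_gridPoint hH (cellIndex_lt hK x)
  -- Rounding down does not change the bid. The sign condition is needed because the step function
  -- has the default value `0` before its first breakpoint.
  have hstrat : ∀ i l x, 0 ≤ x → P.strat i l (ρ x) = P.strat i l x := fun i l x hx => by
    have e : P.strat i l = stepFun K (gridPoint H K) fun k => σ.real 5 i l k := rfl
    rw [e, stepFun_gridPoint hH hK _ hx, stepFun_gridPoint hH hK _ (hρ0 x), hcρ]
  have hvalI : P.IsValid H fun _ => Set.Icc 0 H := ⟨hval.1, hval.2.1, fun i l v hv => by
    rw [← hstrat i l v hv.1]; exact hval.2.2 i l _ (hρD i v)⟩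
  have hvalT : P.IsValid H T := ⟨hval.1, hval.2.1, fun i l v hv => hvalI.2.2 i l v (hTH i hv)⟩
  have hmonI : P.IsMonotone fun _ => Set.Icc 0 H := fun i l x hx y hy hxy => by
    rw [← hstrat i l x hx.1, ← hstrat i l y hy.1]
    exact hmon i l (hρD i x) (hρD i y) (gridPoint_mono hH (cellIndex_mono hxy))
  have hmonT : P.IsMonotone T := fun i l => (hmonI i l).mono (hTH i)
  have hFI : ∀ i, ∀ᵐ v ∂(F i), v ∈ Set.Icc 0 H := fun i => (hT i).mono fun v hv => hTH i hv
  have hDI : ∀ i, ∀ᵐ v ∂(D.marginal i), v ∈ Set.Icc 0 H := fun i =>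
    D.ae_marginal i (D.val_mem i)
  have hωI : ∀ j i, ω j i ∈ Set.Icc 0 H := fun j i => hTH i (hω j i)
  have := fun i => D.isProbabilityMeasure_marginal i
  have hbids : BidsClose P (3 / K) F D.marginal := fun j l B hB => by
    have h1 := abs_le.1 (bidsClose_of_uniformlyClose hmonI hFI hωI hclose j l B hB)
    have h2 := abs_le.1 (abs_empirical_sub_smoothed_le hH hK hm j
      (fun r => hstrat j l _ (hωI r j).1) B)
    -- Sampling contributes `2 / K`, smoothing `1 / K`.
    have e : (3 : ℝ) / K = 2 / K + 1 / K := by ring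
    rw [e]
    exact abs_le.2 ⟨by linarith, by linarith⟩
  -- The equilibrium condition at the grid point `ρ v` is carried over to `v`. A deviation gains at
  -- most `v - ρ v ≤ H / K`, while the payoff of the unchanged bid can only grow since `ρ v ≤ v`; so
  -- `H / K` is lost once.
  have hbneD : IsBNE H (ε' + H / K) D.marginal T P := by
    intro i v hv b hb
    have hvI := hTH i hv
    have h1 : ρ v ≤ v := gridPoint_cellIndex_le hH hK hvI.1
    have h2 : v - ρ v ≤ H / K := sub_gridPoint_cellIndex_le hH hK hvI.2
    have h3 := hbne i (ρ v) (hρD i v) b hb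
    have w := winProb_mem_Icc D.marginal hval i b
    have h4 : interimUtility D.marginal P i v b ≤
        interimUtility D.marginal P i (ρ v) b + H / K := by
      rw [interimUtility_eq, interimUtility_eq]
      nlinarith [w.1, w.2]
    have h5 : ∑ l, P.weight i l * interimUtility D.marginal P i (ρ v) (P.strat i l (ρ v)) ≤
        ∑ l, P.weight i l * interimUtility D.marginal P i v (P.strat i l v) := by
      refine Finset.sum_le_sum fun l _ => mul_le_mul_of_nonneg_left ?_ (hval.1 i l).le
      rw [hstrat i l v hvI.1, interimUtility_eq, interimUtility_eq]
      exact mul_le_mul_of_nonneg_right (by linarith) (winProb_mem_Icc D.marginal hval i _).1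
    linarith
  refine ⟨hκ, hvalT, hmonT, ?_⟩
  refine (IsBNE.of_abs_interimUtility_sub_le hvalT (μ := F) (e := 3 * n * H * (3 / K))
    (fun i v hv b hb => abs_interimUtility_sub_le hval hmonI hmonI hFI hDI hbids i (hTH i hv) hb)
    hbneD).mono ?_
  have e : ε' + H / K + 2 * (3 * n * H * (3 / K)) = ε' + (H + 18 * n * H) / K := by ring
  -- Since `n ≥ 1`, the numerator is at most `19 * n * H`, which the constant `20` in the grid size
  -- covers.
  have : (H + 18 * n * H) / K ≤ ε := by
    rw [div_le_iff₀ hK']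
    nlinarith
  linarith

/-! ### Size estimates, success probability and running time. -/

theorem gridSize_pos {n : ℕ} (hn : 0 < n) {H ε : ℝ} (hH : 0 < H) (hε : 0 < ε) :
    0 < gridSize n H ε := by
  have : (0 : ℝ) < n := by exact_mod_cast hn
  rw [lt_gridSize hε]
  simp only [Nat.cast_zero, zero_mul]
  positivity

/-- The machine counts doublings, whereas the deviation bound needs a natural logarithm. Base `2`
errs on the safe side, and `logSize_le` bounds the excess. -/
theorem log_le_logSize {δ : ℝ} (hδ : 0 < δ) (hδ1 : δ < 1) : Real.log (1 / δ) ≤ logSize δ := by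
  have h1 := Nat.le_ceil (Real.logb 2 (1 / δ))
  have h0 : 0 ≤ Real.log (1 / δ) := Real.log_nonneg (by rw [le_div_iff₀ hδ]; linarith)
  have h2 : Real.log 2 ≤ 1 := by linarith [Real.log_two_lt_d9]
  refine le_trans ?_ h1
  unfold Real.logb
  rw [le_div_iff₀ (Real.log_pos (by norm_num))]
  exact mul_le_of_le_one_right h0 h2

theorem logSize_le {δ : ℝ} (hδ : 0 < δ) (hδ1 : δ < 1) :
    (logSize δ : ℝ) ≤ 2 * (1 + Real.log (1 / δ)) := by
  have h0 : 0 ≤ Real.log (1 / δ) := Real.log_nonneg (by rw [le_div_iff₀ hδ]; linarith)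
  have h2 : 1 / 2 ≤ Real.log 2 := by linarith [Real.log_two_gt_d9]
  have h3 : Real.logb 2 (1 / δ) ≤ 2 * Real.log (1 / δ) := by
    unfold Real.logb
    rw [div_le_iff₀ (by linarith)]
    nlinarith
  have h4 : 0 ≤ Real.logb 2 (1 / δ) :=
    Real.logb_nonneg (by norm_num) (by rw [le_div_iff₀ hδ]; linarith)
  have := Nat.ceil_lt_add_one h4
  unfold logSize
  linarith

theorem le_sampleSize {n : ℕ} (hn : 0 < n) (K L : ℕ) : K * K ≤ sampleSize n K L := by
  unfold sampleSize
  refine Nat.le_mul_of_pos_right _ ?_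
  positivity

theorem computesBNEFromSamples {A : Cmd} (hA : A.DrawFree) {N : ℕ} (hN : 8 ≤ N)
    (hAN : A.arrays ≤ N) {n : ℕ} (hn : 0 < n) {H : ℝ} (hH : 0 < H) {κ : Kind} {ε' : ℝ}
    (hD : ComputesDiscreteBNE A n H κ ε') {ε δ : ℝ} (hε : 0 < ε) (hδ : 0 < δ) (hδ1 : δ < 1) :
    ComputesBNEFromSamples (samplingAlgorithm A N) n H κ ε' ε δ := by
  intro T F _ hTH hT
  set K := gridSize n H ε with hK
  set L := logSize δ with hL
  set m := sampleSize n K L with hm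
  have hK0 : 0 < K := gridSize_pos hn hH hε
  have hmK : K * K ≤ m := le_sampleSize hn K L
  have hKε : 20 * n * H ≤ K * ε :=
    not_lt.1 ((lt_gridSize (n := n) (H := H) hε (k := K)).not.1 (lt_irrefl _))
  refine le_trans (measure_mono_ae ?_) (sampleLaw_not_uniformlyClose_le F (k := K) (m := m)
    hK0 (lt_of_lt_of_le (by positivity) hmK) hδ (log_le_logSize hδ hδ1) ?_)
  · filter_upwards [ae_sample_mem F hT] with ω hω
    intro hnot hclose
    obtain ⟨σ, t, hexec, hbne⟩ := hD (smoothed n hH (fun j => extend (ω j)) hK0 m)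
    obtain ⟨τ, t', hexec', hout, -⟩ := exec_samplingAlgorithm hA hN hAN hH ε' hε hδ
      (fun j => extend (ω j)) hK hL hm hK0 hexec
    refine hnot ⟨τ, t', hexec', ?_⟩
    rw [hout]
    exact isMonotoneBNE_of_smoothed hn hH hK0 hmK hTH hT hω hclose hKε hbne
  · rw [hm, sampleSize]
    push_cast
    rw [pow_two]

theorem stepCount_le {n K L m Y : ℝ} (hK0 : 0 ≤ K) (hm0 : 0 ≤ m) (hn : n ≤ Y)
    (hK : K ≤ Y) (hL : L ≤ Y) (hm : m ≤ Y) (hY : 1 ≤ Y) :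
    (2 * K + 3 * L + 2 * m + 8) + (2 * (n * (3 * K + 5) + 2) +
      (n * (3 * K + m * (2 * K + 7) + 6) + 2)) ≤ 100 * Y ^ 3 := by
  have h3 : Y ≤ Y ^ 3 := le_self_pow₀ hY (by norm_num)
  have h4 : Y ^ 2 ≤ Y ^ 3 := pow_le_pow_right₀ hY (by norm_num)
  have h5 : 1 ≤ Y ^ 3 := one_le_pow₀ hY
  calc _ ≤ (2 * Y + 3 * Y + 2 * Y + 8) +
        (2 * (Y * (3 * Y + 5) + 2) + (Y * (3 * Y + Y * (2 * Y + 7) + 6) + 2)) := by gcongr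
    _ = 2 * Y ^ 3 + 16 * Y ^ 2 + 23 * Y + 14 := by ring
    _ ≤ _ := by linarith

theorem polyTimeSampling {A : Cmd} (hA : A.DrawFree) {N : ℕ} (hN : 8 ≤ N)
    (hAN : A.arrays ≤ N) {n : ℕ} (hn : 0 < n) {H : ℝ} (hH : 0 < H) {Γ : Set ℝ}
    (hΓ : Γ ⊆ Set.Ioi 0) (hpoly : PolyTimeDiscrete A n H Γ) :
    PolyTimeSampling (samplingAlgorithm A N) n H Γ := by
  obtain ⟨C, d, hC⟩ := hpoly
  set a : ℕ := ⌈20 * n * H⌉₊ + 1 + n with ha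
  -- Obtained by inserting `K ≤ a * Q` and `L ≤ 2 * Q` into the sample size, which becomes at most
  -- `c * Q ^ 3`.
  set c : ℕ := a ^ 2 * (2 * n * (a + 1) + 2) with hc
  have ha1 : 1 ≤ a := by omega
  have han : n ≤ a := by omega
  have hca : a ≤ c := by
    rw [hc, pow_two, mul_assoc]
    refine Nat.le_mul_of_pos_right _ (by positivity)
  have hc2 : 2 ≤ c := by
    rw [hc]
    calc 2 = 1 * 2 := rfl
      _ ≤ _ := Nat.mul_le_mul (Nat.one_le_pow _ _ ha1) (by omega)
  -- All sizes are at most `Y = c * Q ^ 3`. The overhead is cubic in `Y`, and the run of `A` costs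
  -- at most `C * (2 * Y ^ 2) ^ d`, so `Y ^ (2 * d + 3)` dominates both.
  refine ⟨(100 + C * 2 ^ d) * c ^ (2 * d + 3), 3 * (2 * d + 3),
    fun ε' hε' ε δ hε hδ hδ1 ω _ => ?_⟩
  have hε'0 : 0 < ε' := hΓ hε'
  set K := gridSize n H ε with hK
  set L := logSize δ with hL
  set m := sampleSize n K L with hm
  have hK0 : 0 < K := gridSize_pos hn hH hε
  obtain ⟨σ, t, hexec, ht⟩ := hC ε' hε' (smoothed n hH (fun j => extend (ω j)) hK0 m)
  obtain ⟨τ, t', hexec', -, ht'⟩ := exec_samplingAlgorithm hA hN hAN hH ε' hε hδ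
      (fun j => extend (ω j)) hK hL hm hK0 hexec
  refine ⟨τ, t', hexec', ?_⟩
  have hlog : 0 ≤ Real.log (1 / δ) := Real.log_nonneg (by rw [le_div_iff₀ hδ]; linarith)
  set Q : ℝ := 1 + 1 / ε + 1 / ε' + Real.log (1 / δ) with hQ
  have i1 : 0 < 1 / ε := by positivity
  have i2 : 0 < 1 / ε' := by positivity
  have hQ1 : 1 ≤ Q := by linarith
  have hQ3 : Q ≤ Q ^ 3 := le_self_pow₀ hQ1 (by norm_num)
  have hKQ : (K : ℝ) ≤ a * Q := by
    have h1 := Nat.ceil_lt_add_one (show 0 ≤ 20 * n * H / ε by positivity)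
    have h2 := Nat.le_ceil (20 * n * H)
    have h3 : (a : ℝ) = (⌈20 * n * H⌉₊ : ℝ) + 1 + n := by rw [ha]; push_cast; ring
    have h4 : (K : ℝ) ≤ 20 * n * H * (1 / ε) + 1 := by
      have : 20 * n * H / ε = 20 * n * H * (1 / ε) := by ring
      rw [hK, gridSize]; linarith
    have h0 : 0 ≤ 20 * n * H := by positivity
    have h5 : (0 : ℝ) ≤ n := by positivity
    calc (K : ℝ) ≤ 20 * n * H * (1 / ε) + 1 := h4
      _ ≤ 20 * n * H * Q + 1 * Q := by
          gcongr
          · linarith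
          · linarith
      _ = (20 * n * H + 1) * Q := by ring
      _ ≤ a * Q := by gcongr; linarith
  have hLQ : (L : ℝ) ≤ 2 * Q := by
    have := logSize_le hδ hδ1
    rw [hL]; linarith
  set Y : ℝ := c * Q ^ 3 with hY
  have hac : (a : ℝ) ≤ c := by exact_mod_cast hca
  have hc2' : (2 : ℝ) ≤ c := by exact_mod_cast hc2
  have hQY : Q ≤ Y := by
    rw [hY]
    exact hQ3.trans (le_mul_of_one_le_left (by positivity) (by linarith))
  have hY1 : 1 ≤ Y := hQ1.trans hQY
  have hKY : (K : ℝ) ≤ Y := hKQ.trans (mul_le_mul hac hQ3 (by positivity) (by positivity))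
  have hLY : (L : ℝ) ≤ Y := hLQ.trans (mul_le_mul hc2' hQ3 (by positivity) (by positivity))
  have hnY : (n : ℝ) ≤ Y := by
    have : (n : ℝ) ≤ c := by exact_mod_cast han.trans hca
    exact this.trans (le_mul_of_one_le_right (by positivity) (one_le_pow₀ hQ1))
  have hmY : (m : ℝ) ≤ Y := by
    calc (m : ℝ) = K * K * (2 * n * (K + 1) + L) := by rw [hm, sampleSize]; push_cast; ring
      _ ≤ (a * Q) * (a * Q) * (2 * n * (a * Q + Q) + 2 * Q) := by gcongr
      _ = Y := by rw [hY, hc]; push_cast; ring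
  have htY : (t : ℝ) ≤ C * 2 ^ d * Y ^ (2 * d) := by
    refine ht.trans ?_
    have hsum : ∑ i : Fin n, ((smoothed n hH (fun j => extend (ω j)) hK0 m).size i : ℝ) =
        n * K := by simp [smoothed]
    rw [hsum, mul_assoc, pow_mul, ← mul_pow]
    gcongr
    -- The supports have total size `n * K ≤ Y ^ 2`, and `1 + 1 / ε' ≤ Q ≤ Y ≤ Y ^ 2`.
    have e1 : (n : ℝ) * K ≤ Y ^ 2 := by rw [pow_two]; gcongr
    have e2 : Y ≤ Y ^ 2 := le_self_pow₀ hY1 (by norm_num)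
    linarith
  have hmain : (t' : ℝ) ≤ 100 * Y ^ 3 + C * 2 ^ d * Y ^ (2 * d) := by
    have h1 : (t' : ℝ) ≤ (2 * K + 3 * L + 2 * m + 8) + (2 * (n * (3 * K + 5) + 2) +
        (n * (3 * K + m * (2 * K + 7) + 6) + 2)) + t := by exact_mod_cast ht'
    have h2 := stepCount_le (Nat.cast_nonneg' K) (Nat.cast_nonneg' m) hnY hKY
      hLY hmY hY1
    exact h1.trans (add_le_add h2 htY)
  calc (t' : ℝ) ≤ 100 * Y ^ 3 + C * 2 ^ d * Y ^ (2 * d) := hmain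
    _ ≤ 100 * Y ^ (2 * d + 3) + C * 2 ^ d * Y ^ (2 * d + 3) := by
        have h3 : Y ^ 3 ≤ Y ^ (2 * d + 3) := pow_le_pow_right₀ hY1 (by omega)
        have h4 : Y ^ (2 * d) ≤ Y ^ (2 * d + 3) := pow_le_pow_right₀ hY1 (by omega)
        gcongr
    _ = _ := by rw [hY, mul_pow, ← pow_mul]; push_cast; ring

end FPA

end

theorem mainTheorem9 (A : FPA.Cmd) (hA : A.DrawFree) :
    ∃ B : FPA.Cmd, ∀ (n : ℕ) (H : ℝ), 0 < n → 0 < H →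
      -- correctness
      (∀ (κ : FPA.Kind) (ε' : ℝ), 0 < ε' → FPA.ComputesDiscreteBNE A n H κ ε' →
        ∀ ε δ : ℝ, 0 < ε → 0 < δ → δ < 1 → FPA.ComputesBNEFromSamples B n H κ ε' ε δ) ∧
      -- running time
      (∀ Γ : Set ℝ, Γ ⊆ Set.Ioi 0 → (∀ ε' ∈ Γ, FPA.ComputesDiscreteBNE A n H .mixed ε') →
        FPA.PolyTimeDiscrete A n H Γ → FPA.PolyTimeSampling B n H Γ) ∧
      -- equilibria of the empirical product distribution
      FPA.EmpiricalEquilibriaTransfer n H := by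
  have hN : 8 ≤ max 8 A.arrays := le_max_left _ _
  have hAN : A.arrays ≤ max 8 A.arrays := le_max_right _ _
  exact ⟨FPA.samplingAlgorithm A (max 8 A.arrays), fun n H hn hH =>
    ⟨fun κ ε' _ hD ε δ hε hδ hδ1 => FPA.computesBNEFromSamples hA hN hAN hn hH hD hε hδ hδ1,
      fun Γ hΓ _ hpoly => FPA.polyTimeSampling hA hN hAN hn hH hΓ hpoly,
      FPA.empiricalEquilibriaTransfer n hH⟩⟩
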